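/- Let $r$ and $n$ be positive integers, $N=nr$, and $G=\mathrm{GL}(N,\mathbb C)$. For a positive integer $q$ let $\Lambda=(\delta_{i+1,j})_{0\le i,j<q}$ be the shift matrix of size $q$ and let $$J_r(q)=\Bigl\{\sum_{0\le k<q}h_k\otimes\Lambda^k \;\Big|\; h_0\in\mathrm{GL}(r,\mathbb C),\ h_1,\dots,h_{q-1}\in\mathrm{Mat}(r,\mathbb C)\Bigr\}\subset\mathrm{GL}(qr,\mathbb C)$$ be the group of invertible block upper triangular Toeplitz matrices: the $(i,j)$ block, of size $r$, is $h_{j-i}$ for $i\le j$ and $0$ for $i>j$. For $c=(c_1,\dots,c_{q-1})\in\mathbb C^{q-1}$ put $M(c,T)=c_1T+\dots+c_{q-1}T^{q-1}$, let $\mu_{i,j}(c)$ be the coefficient of $T^j$ in $M(c,T)^i$ (with $M(c,T)^0=1$), and let $$W_r(q)=\{(\mu_{i,j}(c)\,1_r)_{0\le i,j<q}\mid c\in\mathbb C^{q-1},\ c_1\ne0\}\subset\mathrm{GL}(qr,\mathbb C)$$ (for $q=1$ the condition on $c$ is void and $W_r(1)$ is trivial); this is a subgroup. Let $\lambda$ be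 a partition of $n$ with distinct parts $n_1>\dots>n_s>0$, where $n_i$ occurs $p_i\ge1$ times. Let $H_\lambda\subset G$ be the group of the block diagonal matrices $\mathrm{diag}(h_{i,k})_{1\le i\le s,\,1\le k\le p_i}$ with $h_{i,k}\in J_r(n_i)$, let $N_G(H_\lambda)$ be its normalizer in $G$, and let $W_\lambda=N_G(H_\lambda)/H_\lambda$, with the quotient topology. Let $\mathcal P_i\simeq\mathfrak S_{p_i}$ be the group of the block permutation matrices $P_\sigma=(\delta_{j,\sigma(k)}1_{n_ir})_{1\le j,k\le p_i}$, $\sigma\in\mathfrak S_{p_i}$; it acts on $W_r(n_i)^{p_i}$ (block diagonal matrices) by conjugation, that is, by permutation of the diagonal blocks: $(X_k)_k\mapsto(X_{\sigma^{-1}(k)})_k$. Then: (1) $N_G(H_\lambda)=\{g\in G\mid ghg^{-1}\in H_\lambda\text{ for all }h\in H_\lambda\}$. (2) There is an isomorphism of groups $$\prod_{1\le i\le s}\bigl(W_r(n_i)^{p_i}\rtimes\mathcal P_i\bigr)\;\simeq\; W_\lambda$$ that takes the family of pairs $((X_{i,k})_{k},P_{\sigma_i})_{i}$ to the class of $\mathrm{diag}(X_{i,k})_{i,k}\cdot\mathrm{diag}(P_{\sigma_1},\dots,P_{\sigma_s})\in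 N_G(H_\lambda)$. (3) The same formula gives an isomorphism $\bigl(\prod_iW_r(n_i)^{p_i}\bigr)\rtimes\prod_i\mathfrak S_{p_i}\simeq W_\lambda$, and it embeds $\prod_iW_r(n_i)^{p_i}$ homeomorphically onto an open subgroup of $W_\lambda$. The group $\prod_iW_r(n_i)^{p_i}$ is connected, and, as a set of block diagonal matrices, it is a complex submanifold of $\mathrm{Mat}(N,\mathbb C)$ of dimension $\sum_ip_i(n_i-1)$. So $W_\lambda$ is a semidirect product of a connected group of complex dimension $\sum_ip_i(n_i-1)$ and the finite group $\prod_i\mathfrak S_{p_i}$. (4) In the non-confluent case $\lambda=(1,\dots,1)$, $\sigma\mapsto P_\sigma=(\delta_{a,\sigma(b)}1_r)_{1\le a,b\le n}$ induces an isomorphism $\mathfrak S_n\simeq W_\lambda$. -/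

import Mathlib

open scoped Matrix Kronecker SemidirectProduct

noncomputable section

namespace WeylJordan

/-! ### The generalized Jordan groups -/

/-- The block upper triangular Toeplitz matrix `∑_{0 ≤ k < q} h_k ⊗ Λ^k`, with `q × q` blocks of
size `r`: its `(i, j)` block is `h_{j - i}` for `i ≤ j` and `0` for `i > j`. -/
def toeplitz (r q : ℕ) (h : ℕ → Matrix (Fin r) (Fin r) ℂ) :
    Matrix (Fin q × Fin r) (Fin q × Fin r) ℂ :=
  Matrix.of fun x y => if x.1 ≤ y.1 then h ((y.1 : ℕ) - (x.1 : ℕ)) x.2 y.2 else 0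

theorem toeplitz_mul (r q : ℕ) (f g : PowerSeries (Matrix (Fin r) (Fin r) ℂ)) :
    toeplitz r q (fun k => PowerSeries.coeff k f) * toeplitz r q (fun k => PowerSeries.coeff k g) =
      toeplitz r q (fun k => PowerSeries.coeff k (f * g)) := by
  ext ⟨i, a⟩ ⟨j, b⟩
  simp only [toeplitz, Matrix.mul_apply, Matrix.of_apply, Fintype.sum_prod_type]
  have key : ∀ k : Fin q, (∑ y : Fin r,
      (if i ≤ k then PowerSeries.coeff ((k : ℕ) - (i : ℕ)) f a y else 0) *
        (if k ≤ j then PowerSeries.coeff ((j : ℕ) - (k : ℕ)) g y b else 0)) =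
      if i ≤ k ∧ k ≤ j then (PowerSeries.coeff ((k : ℕ) - (i : ℕ)) f *
        PowerSeries.coeff ((j : ℕ) - (k : ℕ)) g) a b else 0 := by
    intro k
    by_cases h1 : i ≤ k <;> by_cases h2 : k ≤ j <;> simp [h1, h2, Matrix.mul_apply]
  rw [Finset.sum_congr rfl fun k _ => key k]
  by_cases hij : i ≤ j
  · rw [if_pos hij, PowerSeries.coeff_mul, Matrix.sum_apply, ← Finset.sum_filter]
    have hi : (i : ℕ) ≤ j := hij
    refine Finset.sum_bij' (fun k _ => ((k : ℕ) - (i : ℕ), (j : ℕ) - (k : ℕ)))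
      (fun m hm => ⟨m.1 + i, ?_⟩) ?_ ?_ ?_ ?_ ?_
    · have := Finset.HasAntidiagonal.mem_antidiagonal.1 hm
      have := j.2
      omega
    · intro k hk
      simp only [Finset.mem_filter, Finset.mem_univ, true_and, Fin.le_def] at hk
      simp only [Finset.HasAntidiagonal.mem_antidiagonal]
      omega
    · intro m hm
      have := Finset.HasAntidiagonal.mem_antidiagonal.1 hm
      simp only [Finset.mem_filter, Finset.mem_univ, true_and, Fin.le_def]
      omega
    · intro k hk
      simp only [Finset.mem_filter, Finset.mem_univ, true_and, Fin.le_def] at hk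
      ext
      simp only
      omega
    · intro m hm
      have := Finset.HasAntidiagonal.mem_antidiagonal.1 hm
      ext <;> simp only <;> omega
    · intro k hk
      rfl
  · rw [if_neg hij]
    exact Finset.sum_eq_zero fun k _ => if_neg fun h => hij (h.1.trans h.2)

theorem toeplitz_one (r q : ℕ) :
    toeplitz r q (fun k => PowerSeries.coeff k (1 : PowerSeries (Matrix (Fin r) (Fin r) ℂ))) =
      1 := by
  ext ⟨i, a⟩ ⟨j, b⟩
  simp only [toeplitz, Matrix.of_apply, PowerSeries.coeff_one, Matrix.one_apply, Prod.mk.injEq]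
  by_cases hij : i = j
  · subst hij
    simp [Matrix.one_apply]
  · by_cases h : i ≤ j
    · have : ¬ ((j : ℕ) - (i : ℕ) = 0) := by
        have h1 : (i : ℕ) ≤ j := h
        have h2 : (i : ℕ) ≠ j := fun e => hij (Fin.ext e)
        omega
      simp [h, hij, this]
    · simp [h, hij]

/-- The Jordan group `J_r(q)`: all matrices `∑_{0 ≤ k < q} h_k ⊗ Λ^k` with `h_0` invertible. -/
def jordanGroup (r q : ℕ) : Subgroup (GL (Fin q × Fin r) ℂ) where
  carrier := {g | ∃ h : ℕ → Matrix (Fin r) (Fin r) ℂ, IsUnit (h 0) ∧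
    (g : Matrix (Fin q × Fin r) (Fin q × Fin r) ℂ) = toeplitz r q h}
  mul_mem' := by
    rintro g g' ⟨h, hu, hg⟩ ⟨h', hu', hg'⟩
    refine ⟨fun k => PowerSeries.coeff k (PowerSeries.mk h * PowerSeries.mk h'), ?_, ?_⟩
    · simpa [PowerSeries.coeff_mul] using hu.mul hu'
    · rw [← toeplitz_mul]
      simp [hg, hg']
  one_mem' := by
    refine ⟨fun k => PowerSeries.coeff k (1 : PowerSeries (Matrix (Fin r) (Fin r) ℂ)), ?_, ?_⟩
    · simp
    · rw [toeplitz_one, Units.val_one]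
  inv_mem' := by
    rintro g ⟨h, ⟨u, hu⟩, hg⟩
    refine ⟨fun k => PowerSeries.coeff k (PowerSeries.invOfUnit (PowerSeries.mk h) u), ?_, ?_⟩
    · simp
    · refine Units.inv_eq_of_mul_eq_one_right ?_
      have h1 : (g : Matrix (Fin q × Fin r) (Fin q × Fin r) ℂ) =
          toeplitz r q (fun k => PowerSeries.coeff k (PowerSeries.mk h)) := by simp [hg]
      rw [h1, toeplitz_mul, PowerSeries.mul_invOfUnit _ _ (by simp [hu]), toeplitz_one]

/-! ### The groups `W_r(q)` -/

/-- The formal power series `M(c, T) = c_1 T + c_2 T^2 + ⋯`. -/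
def genSeries (c : ℕ → ℂ) : PowerSeries ℂ := PowerSeries.mk fun k => if k = 0 then 0 else c k

/-- `μ_{i,j}(c)` is the coefficient of `T^j` in `M(c, T)^i`. -/
def mu (c : ℕ → ℂ) (i j : ℕ) : ℂ := PowerSeries.coeff j (genSeries c ^ i)

/-- The matrix `(μ_{i,j}(c))_{0 ≤ i, j < q}`. It only depends on `c_1, …, c_{q-1}`. -/
def muMatrix (q : ℕ) (c : ℕ → ℂ) : Matrix (Fin q) (Fin q) ℂ := Matrix.of fun i j => mu c i j

theorem constantCoeff_genSeries (c : ℕ → ℂ) : PowerSeries.constantCoeff (genSeries c) = 0 := by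
  simp [genSeries, ← PowerSeries.coeff_zero_eq_constantCoeff_apply]

theorem mu_of_lt (c : ℕ → ℂ) {i j : ℕ} (h : j < i) : mu c i j = 0 :=
  PowerSeries.coeff_of_lt_order _ (lt_of_lt_of_le (by exact_mod_cast h)
    (PowerSeries.le_order_pow_of_constantCoeff_eq_zero i (constantCoeff_genSeries c)))

theorem mu_one (c : ℕ → ℂ) (j : ℕ) : mu c 1 j = if j = 0 then 0 else c j := by
  simp [mu, genSeries]

theorem mu_self (c : ℕ → ℂ) (i : ℕ) : mu c i i = c 1 ^ i := by
  induction i with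
  | zero => simp [mu]
  | succ i ih =>
    have h : mu c (i + 1) (i + 1) = ∑ x ∈ Finset.HasAntidiagonal.antidiagonal (i + 1), mu c i x.1 * mu c 1 x.2 := by
      simp [mu, pow_succ, PowerSeries.coeff_mul]
    rw [h, Finset.sum_eq_single (i, 1), ih, mu_one, pow_succ]
    · simp
    · rintro ⟨a, b⟩ hab hne
      rw [Finset.HasAntidiagonal.mem_antidiagonal] at hab
      simp only at hab ⊢
      rcases lt_trichotomy a i with h1 | h1 | h1
      · rw [mu_of_lt c h1, zero_mul]
      · exact absurd (Prod.ext h1 (by simp only; omega)) hne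
      · have : b = 0 := by omega
        simp [this, mu_one]
    · intro h'
      simp [Finset.HasAntidiagonal.mem_antidiagonal] at h'

theorem mu_subst (a b : ℕ → ℂ) (q i j : ℕ) (hj : j < q) :
    PowerSeries.coeff j (PowerSeries.subst (genSeries b) (genSeries a ^ i)) =
      ∑ k : Fin q, mu a i k * mu b k j := by
  have hb : PowerSeries.HasSubst (genSeries b) :=
    PowerSeries.HasSubst.of_constantCoeff_zero' (constantCoeff_genSeries b)
  rw [PowerSeries.coeff_subst' hb, finsum_eq_sum_of_support_subset (s := Finset.range q),
    ← Fin.sum_univ_eq_sum_range (fun k => PowerSeries.coeff k (genSeries a ^ i) •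
      PowerSeries.coeff j (genSeries b ^ k))]
  · rfl
  · intro k hk
    by_contra hk'
    simp only [Finset.coe_range, Set.mem_Iio, not_lt] at hk'
    apply hk
    have := mu_of_lt b (lt_of_lt_of_le hj hk')
    simp only [mu] at this
    simp [this]

/-- Composition of truncated power series: the matrices `μ(c)` are closed under products. -/
theorem muMatrix_mul (q : ℕ) (a b : ℕ → ℂ) :
    muMatrix q a * muMatrix q b = muMatrix q fun j =>
      PowerSeries.coeff j (PowerSeries.subst (genSeries b) (genSeries a)) := by
  have hb : PowerSeries.HasSubst (genSeries b) :=
    PowerSeries.HasSubst.of_constantCoeff_zero' (constantCoeff_genSeries b)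
  have h0 : PowerSeries.coeff 0 (PowerSeries.subst (genSeries b) (genSeries a)) = 0 := by
    have := mu_subst a b 1 1 0 (by norm_num)
    rw [pow_one] at this
    simp [this, mu_one]
  have h : genSeries (fun j => PowerSeries.coeff j (PowerSeries.subst (genSeries b) (genSeries a)))
      = PowerSeries.subst (genSeries b) (genSeries a) := by
    ext k
    by_cases hk : k = 0
    · subst hk
      rw [h0]
      simp [genSeries]
    · simp [genSeries, hk]
  ext i j
  simp only [muMatrix, Matrix.mul_apply, Matrix.of_apply]
  rw [← mu_subst a b q i j j.2, mu, h, PowerSeries.subst_pow hb]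

theorem muMatrix_congr {q : ℕ} {a b : ℕ → ℂ} (h : ∀ k, 0 < k → k < q → a k = b k) :
    muMatrix q a = muMatrix q b := by
  have key : ∀ i j : ℕ, j < q → mu a i j = mu b i j := by
    intro i
    induction i with
    | zero => intro j _; simp [mu]
    | succ i ih =>
      intro j hj
      have e : ∀ c : ℕ → ℂ, mu c (i + 1) j =
          ∑ x ∈ Finset.HasAntidiagonal.antidiagonal j, mu c i x.1 * mu c 1 x.2 := by
        intro c
        simp [mu, pow_succ, PowerSeries.coeff_mul]
      rw [e, e]
      refine Finset.sum_congr rfl fun x hx => ?_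
      have hx' := Finset.HasAntidiagonal.mem_antidiagonal.1 hx
      rw [ih x.1 (by omega), mu_one, mu_one]
      by_cases h2 : x.2 = 0
      · simp [h2]
      · rw [if_neg h2, if_neg h2, h x.2 (by omega) (by omega)]
  ext i j
  exact key i j j.2

theorem muMatrix_id (q : ℕ) : muMatrix q (fun k => if k = 1 then 1 else 0) = 1 := by
  have h : genSeries (fun k => if k = 1 then 1 else 0) = PowerSeries.X := by
    ext k
    by_cases hk : k = 0
    · subst hk; simp [genSeries]
    · simp [genSeries, hk, PowerSeries.coeff_X]
  ext i j
  simp only [muMatrix, mu, h, Matrix.of_apply, PowerSeries.coeff_X_pow, Matrix.one_apply]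
  by_cases hij : i = j
  · simp [hij]
  · rw [if_neg hij, if_neg fun e => hij (Fin.ext e.symm)]

theorem isUnit_muMatrix (q : ℕ) {c : ℕ → ℂ} (hc : c 1 ≠ 0) : IsUnit (muMatrix q c) := by
  rw [Matrix.isUnit_iff_isUnit_det, Matrix.det_of_isUpperTriangular]
  · simp only [muMatrix, Matrix.of_apply, mu_self]
    exact isUnit_iff_ne_zero.2 (Finset.prod_ne_zero_iff.2 fun i _ => pow_ne_zero _ hc)
  · intro i j hij
    exact mu_of_lt c hij

theorem exists_muMatrix_inv (q : ℕ) {c : ℕ → ℂ} (hc : c 1 ≠ 0) :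
    ∃ a : ℕ → ℂ, a 1 ≠ 0 ∧ muMatrix q a * muMatrix q c = 1 := by
  by_cases hq : q ≤ 1
  · refine ⟨fun k => if k = 1 then 1 else 0, by simp, ?_⟩
    rw [muMatrix_id, one_mul, ← muMatrix_id]
    exact muMatrix_congr fun k h1 h2 => by omega
  push Not at hq
  set one : Fin q := ⟨1, hq⟩ with hone
  set B := muMatrix q c with hB
  have hBu : IsUnit B.det := (Matrix.isUnit_iff_isUnit_det _).1 (isUnit_muMatrix q hc)
  set a : ℕ → ℂ := fun k => if h : k < q then B⁻¹ one ⟨k, h⟩ else 0 with ha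
  have hrow : ∀ j : Fin q, ∑ k : Fin q, a k * mu c k j = if one = j then 1 else 0 := by
    intro j
    have := congrFun (congrFun (Matrix.nonsing_inv_mul B hBu) one) j
    rw [Matrix.mul_apply, Matrix.one_apply] at this
    rw [← this]
    refine Finset.sum_congr rfl fun k _ => ?_
    simp [ha, hB, muMatrix]
  have ha0 : a 0 = 0 := by
    have := hrow ⟨0, by omega⟩
    rw [Finset.sum_eq_single ⟨0, by omega⟩] at this
    · simpa [mu, hone] using this
    · intro k _ hk
      have : 0 < (k : ℕ) := Nat.pos_of_ne_zero fun e => hk (Fin.ext e)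
      rw [mu_of_lt c this, mul_zero]
    · simp
  have ha1 : a 1 * c 1 = 1 := by
    have := hrow one
    rw [Finset.sum_eq_single one] at this
    · simpa [mu_one, hone] using this
    · intro k _ hk
      have h1 : (k : ℕ) ≠ 1 := fun e => hk (Fin.ext e)
      rcases Nat.lt_or_ge (k : ℕ) 1 with h | h
      · have : (k : ℕ) = 0 := by omega
        rw [this, ha0, zero_mul]
      · rw [mu_of_lt c (show (1 : ℕ) < k by omega), mul_zero]
    · simp
  refine ⟨a, left_ne_zero_of_mul_eq_one ha1, ?_⟩
  rw [hB, muMatrix_mul, ← muMatrix_id]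
  refine muMatrix_congr fun j h1 h2 => ?_
  have e := mu_subst a c q 1 j h2
  rw [pow_one] at e
  rw [e]
  have e2 := hrow ⟨j, h2⟩
  have e3 : ∑ k : Fin q, mu a 1 k * mu c k j = ∑ k : Fin q, a k * mu c k j := by
    refine Finset.sum_congr rfl fun k _ => ?_
    rw [mu_one]
    by_cases hk : (k : ℕ) = 0
    · rw [if_pos hk, hk, ha0]
    · rw [if_neg hk]
  rw [e3]
  simp only at e2
  rw [e2]
  simp only [hone, Fin.mk.injEq, eq_comm]

/-- The group `W_r(q)` of the block matrices `μ(c) = (μ_{i,j}(c) 1_r)_{0 ≤ i, j < q}` with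
`c_1 ≠ 0`. Entries `c_k` with `k = 0` or `k ≥ q` do not occur in `μ(c)`, so that `c` amounts to a
vector `(c_1, …, c_{q-1})`, and `W_r(1)` is the trivial group. -/
def wGroup (r q : ℕ) : Subgroup (GL (Fin q × Fin r) ℂ) where
  carrier := {g | ∃ c : ℕ → ℂ, c 1 ≠ 0 ∧ (g : Matrix (Fin q × Fin r) (Fin q × Fin r) ℂ) =
    muMatrix q c ⊗ₖ (1 : Matrix (Fin r) (Fin r) ℂ)}
  mul_mem' := by
    rintro g g' ⟨a, ha, hg⟩ ⟨b, hb, hg'⟩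
    refine ⟨fun j => PowerSeries.coeff j (PowerSeries.subst (genSeries b) (genSeries a)), ?_, ?_⟩
    · have e := mu_subst a b 2 1 1 (by norm_num)
      rw [pow_one] at e
      beta_reduce
      rw [e, Fin.sum_univ_two]
      simp [mu_one, ha, hb]
    · rw [← muMatrix_mul, Units.val_mul, hg, hg', ← Matrix.mul_kronecker_mul, one_mul]
  one_mem' := by
    refine ⟨fun k => if k = 1 then 1 else 0, by simp, ?_⟩
    rw [muMatrix_id, Matrix.one_kronecker_one, Units.val_one]
  inv_mem' := by
    rintro g ⟨c, hc, hg⟩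
    obtain ⟨a, ha, h⟩ := exists_muMatrix_inv q hc
    refine ⟨a, ha, Units.inv_eq_of_mul_eq_one_left ?_⟩
    rw [hg, ← Matrix.mul_kronecker_mul, h, one_mul, Matrix.one_kronecker_one]

/-! ### The group `H_λ` and its Weyl group

The partition `λ` has the distinct parts `n i` with multiplicities `p i`, `i : Fin s`. Its blocks
are indexed by the pairs `⟨i, k⟩` with `k : Fin (p i)`, and the block `⟨i, k⟩` has size
`n i * r`. -/

/-- The index set of the blocks. -/
abbrev Blk {s : ℕ} (p : Fin s → ℕ) : Type := (i : Fin s) × Fin (p i)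

/-- The index set of the rows and columns; it has `N = (∑ i, p i * n i) * r` elements. -/
abbrev Idx (r : ℕ) {s : ℕ} (n p : Fin s → ℕ) : Type := (b : Blk p) × (Fin (n b.1) × Fin r)

/-- `(X_b)_b ↦ diag(X_b)_b`, as a homomorphism into `GL(N)`. -/
def blockDiag (r : ℕ) {s : ℕ} (n p : Fin s → ℕ) :
    (∀ b : Blk p, GL (Fin (n b.1) × Fin r) ℂ) →* GL (Idx r n p) ℂ :=
  (Units.map (Matrix.blockDiagonal'RingHom
    (fun b : Blk p => Fin (n b.1) × Fin r) ℂ : _ →* Matrix (Idx r n p) (Idx r n p) ℂ)).comp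
    MulEquiv.piUnits.symm.toMonoidHom

/-- `H_λ = {diag(h_b)_b | h_⟨i,k⟩ ∈ J_r(n_i)}`. -/
def hGroup (r : ℕ) {s : ℕ} (n p : Fin s → ℕ) : Subgroup (GL (Idx r n p) ℂ) :=
  (Subgroup.pi Set.univ fun b : Blk p => jordanGroup r (n b.1)).map (blockDiag r n p)

/-- The normalizer of `H_λ` in `GL(N)`. -/
abbrev hNormalizer (r : ℕ) {s : ℕ} (n p : Fin s → ℕ) : Subgroup (GL (Idx r n p) ℂ) :=
  Subgroup.normalizer (hGroup r n p : Set (GL (Idx r n p) ℂ))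

/-- The Weyl group `W_λ = N_G(H_λ) / H_λ` (with the quotient topology). -/
abbrev weylGroup (r : ℕ) {s : ℕ} (n p : Fin s → ℕ) : Type :=
  ↥(hNormalizer r n p) ⧸ (hGroup r n p).subgroupOf (hNormalizer r n p)

/-- The block permutation matrix `P_σ`, for a family `σ = (σ_i)_i` of permutations: it is block
diagonal with respect to `i`, with `i`-th block `(δ_{j,σ_i(k)} 1_{n_i r})_{j,k}`. -/
def permGL (r : ℕ) {s : ℕ} (n p : Fin s → ℕ) :
    (∀ i, Equiv.Perm (Fin (p i))) →* GL (Idx r n p) ℂ :=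
  MonoidHom.toHomUnits
    { toFun := fun σ => Matrix.of fun x y : Idx r n p =>
        if x = ⟨⟨y.1.1, σ y.1.1 y.1.2⟩, y.2⟩ then (1 : ℂ) else 0
      map_one' := by
        ext x y
        simp only [Matrix.of_apply, Pi.one_apply, Equiv.Perm.one_apply, Matrix.one_apply]
        rfl
      map_mul' := by
        intro σ τ
        ext x y
        simp only [Matrix.mul_apply, Matrix.of_apply, mul_ite, mul_one, mul_zero, Finset.sum_ite_eq',
          Finset.mem_univ, if_true]
        rfl }

/-- `W_r(n_i)^{p_i}` for all `i` together: the group `∏_i W_r(n_i)^{p_i}`. -/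
abbrev WProd (r : ℕ) {s : ℕ} (n p : Fin s → ℕ) : Type :=
  ∀ i, Fin (p i) → ↥(wGroup r (n i))

/-- The matrix `diag(X_{i,k}) · P_σ` for `X ∈ ∏_i W_r(n_i)^{p_i}` and `σ ∈ ∏_i 𝔖_{p_i}`. -/
def toGL (r : ℕ) {s : ℕ} (n p : Fin s → ℕ) (X : WProd r n p)
    (σ : ∀ i, Equiv.Perm (Fin (p i))) : GL (Idx r n p) ℂ :=
  blockDiag r n p (fun b => (X b.1 b.2 : GL (Fin (n b.1) × Fin r) ℂ)) * permGL r n p σ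

/-- `W_r(q)^m ⋊ 𝔖_m`, where `𝔖_m` permutes the factors: `(σ • X)_k = X_{σ⁻¹(k)}`. This is the action
of `P_σ` on `diag(X_1, …, X_m)` by conjugation. -/
abbrev WreathW (r q m : ℕ) : Type :=
  (Fin m → ↥(wGroup r q)) ⋊[mulAutArrow] Equiv.Perm (Fin m)

/-- The action of `∏_i 𝔖_{p_i}` on `∏_i W_r(n_i)^{p_i}`, factor by
factor: `(σ • X)_{i,k} = X_{i,σ_i⁻¹(k)}`. -/
def permAction (r : ℕ) {s : ℕ} (n p : Fin s → ℕ) :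
    (∀ i, Equiv.Perm (Fin (p i))) →* MulAut (WProd r n p) where
  toFun σ :=
    { toFun := fun X i k => X i ((σ i)⁻¹ k)
      invFun := fun X i k => X i (σ i k)
      left_inv := fun X => by ext1 i; ext1 k; simp
      right_inv := fun X => by ext1 i; ext1 k; simp
      map_mul' := fun X Y => rfl }
  map_one' := rfl
  map_mul' σ τ := by
    apply MulEquiv.ext
    intro X
    ext1 i
    ext1 k
    exact congrArg (X i) (by simp [mul_inv_rev])

/-- `S` is a (locally closed, embedded) complex submanifold of dimension `d` of the complex vector
space `E`: near each of its points a biholomorphic chart of `E` takes `S` to a linear subspace of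
dimension `d`. -/
def IsComplexSubmanifold {E : Type*} [NormedAddCommGroup E] [NormedSpace ℂ E] (S : Set E)
    (d : ℕ) : Prop :=
  ∀ x ∈ S, ∃ (φ : OpenPartialHomeomorph E E) (F : Submodule ℂ E),
    x ∈ φ.source ∧ DifferentiableOn ℂ φ φ.source ∧ DifferentiableOn ℂ φ.symm φ.target ∧
      FiniteDimensional ℂ F ∧ Module.finrank ℂ F = d ∧ φ '' (φ.source ∩ S) = φ.target ∩ F

end WeylJordan

end

open WeylJordan

/-! The argument replaces `H_λ` by its commutant, a commutative algebra whose automorphisms are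
visible. `J_r(q)` is the centralizer in the general linear group of the shift `Λ`
(`mem_jordanGroup_iff`), and its own commutant consists of the scalar series `F(Λ)`, a copy of
`ℂ[T]/(T^q)`. Hence the commutant of `H_λ` is the product over the blocks `b` of the local algebras
`ℂ[T]/(T^{n_b})` (`forall_commute_hGroup_iff`).

If `g H_λ g⁻¹ ⊆ H_λ`, then `x ↦ g⁻¹ x g` maps this algebra into itself (`inv_mul_scalarBlocks`). It
permutes the block idempotents, because idempotents of a local ring are `0` and `1`, and the trace
shows that block sizes are preserved (`exists_perm_of_mul_scalarBlocks`). Dividing by a block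
permutation leaves a block diagonal matrix, each of whose blocks conjugates `Λ` to some `F(Λ)` with
`F` of order one modulo `T^q`. The matrix `μ(c)` with `M(c, T) = F` does the inverse conjugation
(`shift_mul_muMatrix`), so the block lies in `W_r(q) J_r(q)` (`exists_wGroup_mul_jordanGroup`). This
gives surjectivity onto `W_λ`, and also (1), since the inclusion was used in one direction only.

Injectivity holds because `H_λ` is block diagonal and because row zero of `μ(c)` is that of the
identity, while a Toeplitz matrix is determined by its row zero. The same observation recovers the
`J_r(q)` factor of a product continuously, whence the open embedding. Finally, row one of `μ(c)` is
`c` itself, so `∏_i W_r(n_i)^{p_i}` is a graph over its parameters, hence a submanifold; it is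
connected as a product of images of `ℂ^× × ℂ^ℕ`. -/

namespace WeylJordan

/-! ### Block Toeplitz matrices as images of power series -/

/-- Truncation of a matrix power series to a block Toeplitz matrix, as a ring homomorphism. -/
noncomputable def toeplitzHom (r q : ℕ) :
    PowerSeries (Matrix (Fin r) (Fin r) ℂ) →+* Matrix (Fin q × Fin r) (Fin q × Fin r) ℂ where
  toFun F := toeplitz r q fun k => PowerSeries.coeff k F
  map_one' := toeplitz_one r q
  map_mul' F G := (toeplitz_mul r q F G).symm
  map_zero' := by ext x y; simp [toeplitz]
  map_add' F G := by
    ext x y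
    by_cases h : x.1 ≤ y.1 <;> simp [toeplitz, h]

theorem toeplitzHom_apply (r q : ℕ) (F : PowerSeries (Matrix (Fin r) (Fin r) ℂ)) :
    toeplitzHom r q F = toeplitz r q fun k => PowerSeries.coeff k F := rfl

theorem toeplitzHom_mk (r q : ℕ) (h : ℕ → Matrix (Fin r) (Fin r) ℂ) :
    toeplitzHom r q (PowerSeries.mk h) = toeplitz r q h := by
  simp [toeplitzHom_apply]

theorem toeplitz_congr {r q : ℕ} {h h' : ℕ → Matrix (Fin r) (Fin r) ℂ}
    (e : ∀ k < q, h k = h' k) : toeplitz r q h = toeplitz r q h' := by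
  ext x y
  simp only [toeplitz, Matrix.of_apply]
  rw [e _ (by have := y.1.2; omega)]

theorem toeplitz_zero_apply {r q : ℕ} (h : ℕ → Matrix (Fin r) (Fin r) ℂ) {k : ℕ} (hk : k < q)
    (a b : Fin r) : toeplitz r q h (⟨0, by omega⟩, a) (⟨k, hk⟩, b) = h k a b := by
  have h0 : (⟨0, by omega⟩ : Fin q) ≤ ⟨k, hk⟩ := Nat.zero_le k
  exact (if_pos h0 : ite _ (h (k - 0) a b) (0 : ℂ) = _)

theorem toeplitz_injOn {r q : ℕ} {h h' : ℕ → Matrix (Fin r) (Fin r) ℂ}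
    (e : toeplitz r q h = toeplitz r q h') {k : ℕ} (hk : k < q) : h k = h' k := by
  ext a b
  have := congrFun (congrFun e (⟨0, by omega⟩, a)) (⟨k, hk⟩, b)
  rwa [toeplitz_zero_apply, toeplitz_zero_apply] at this

/-- The matrix `∑_k F_k 1_r ⊗ Λ^k` attached to a scalar power series `F`. -/
noncomputable def scalarToeplitz (r q : ℕ) :
    PowerSeries ℂ →+* Matrix (Fin q × Fin r) (Fin q × Fin r) ℂ :=
  (toeplitzHom r q).comp (PowerSeries.map (Matrix.scalar (Fin r)))

theorem scalarToeplitz_apply (r q : ℕ) (F : PowerSeries ℂ) (x y : Fin q × Fin r) :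
    scalarToeplitz r q F x y =
      if x.2 = y.2 then PowerSeries.coeff y.1 (PowerSeries.X ^ (x.1 : ℕ) * F) else 0 := by
  rw [PowerSeries.coeff_X_pow_mul']
  simp only [scalarToeplitz, RingHom.comp_apply, toeplitzHom_apply, toeplitz, Matrix.of_apply,
    PowerSeries.coeff_map, Matrix.scalar_apply, Matrix.diagonal_apply, Fin.le_def]
  by_cases h1 : x.2 = y.2 <;> simp [h1]

/-- Row zero displays the coefficients of `F` below degree `q`. Thus the image of `scalarToeplitz`
is `ℂ[T]/(T^q)`, and matrix identities become divisibility by `X ^ q`. -/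
theorem scalarToeplitz_eq_zero_iff {r q : ℕ} (hr : 0 < r) {F : PowerSeries ℂ} :
    scalarToeplitz r q F = 0 ↔ PowerSeries.X ^ q ∣ F := by
  rw [PowerSeries.X_pow_dvd_iff]
  constructor
  · intro h k hk
    have := congrFun (congrFun h (⟨0, by omega⟩, ⟨0, hr⟩)) (⟨k, hk⟩, ⟨0, hr⟩)
    simpa [scalarToeplitz_apply] using this
  · intro h
    ext x y
    rw [scalarToeplitz_apply, PowerSeries.coeff_X_pow_mul', Matrix.zero_apply,
      h _ (by have := y.1.2; omega)]
    simp

theorem scalarToeplitz_eq_of_dvd {r q : ℕ} (hr : 0 < r) {F G : PowerSeries ℂ}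
    (h : PowerSeries.X ^ q ∣ F - G) : scalarToeplitz r q F = scalarToeplitz r q G := by
  rw [← sub_eq_zero, ← map_sub]
  exact (scalarToeplitz_eq_zero_iff hr).2 h

/-- The algebra of truncated scalar power series is local, so its idempotents are trivial. -/
theorem scalarToeplitz_idempotent {r q : ℕ} (hr : 0 < r) {F : PowerSeries ℂ}
    (h : scalarToeplitz r q F * scalarToeplitz r q F = scalarToeplitz r q F) :
    scalarToeplitz r q F = 0 ∨ scalarToeplitz r q F = 1 := by
  have h1 : PowerSeries.X ^ q ∣ F * (F - 1) := by
    rw [← scalarToeplitz_eq_zero_iff hr, map_mul, map_sub, map_one, mul_sub, h, mul_one, sub_self]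
  rcases IsLocalRing.isUnit_or_isUnit_one_sub_self F with hF | hF
  · right
    rw [← map_one (scalarToeplitz r q)]
    exact scalarToeplitz_eq_of_dvd hr (hF.dvd_mul_left.1 h1)
  · left
    have hF' : IsUnit (F - 1) := by
      rw [← neg_sub]
      exact hF.neg
    exact (scalarToeplitz_eq_zero_iff hr).2 (hF'.dvd_mul_right.1 h1)

/-! ### Commutation with the shift matrix -/

theorem shift_apply {r q : ℕ} (x y : Fin q × Fin r) :
    scalarToeplitz r q PowerSeries.X x y =
      if (x.1 : ℕ) + 1 = y.1 ∧ x.2 = y.2 then 1 else 0 := by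
  rw [scalarToeplitz_apply, ← pow_succ, PowerSeries.coeff_X_pow]
  by_cases h : x.2 = y.2 <;> simp [h, eq_comm]

theorem mul_shift_succ {r q : ℕ} {ι : Type*} (M : Matrix ι (Fin q × Fin r) ℂ) (x : ι) {j : ℕ}
    (hj : j + 1 < q) (b : Fin r) :
    (M * scalarToeplitz r q PowerSeries.X) x (⟨j + 1, hj⟩, b) = M x (⟨j, by omega⟩, b) := by
  rw [Matrix.mul_apply, Finset.sum_eq_single (⟨j, by omega⟩, b)]
  · simp [shift_apply]
  · rintro ⟨k, c⟩ - hne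
    rw [shift_apply, if_neg, mul_zero]
    rintro ⟨h1, h2⟩
    simp only at h1 h2
    exact hne (Prod.ext (Fin.ext (by simp only; omega)) h2)
  · simp

theorem mul_shift_zero {r q : ℕ} {ι : Type*} (M : Matrix ι (Fin q × Fin r) ℂ) (x : ι)
    (hq : 0 < q) (b : Fin r) :
    (M * scalarToeplitz r q PowerSeries.X) x (⟨0, hq⟩, b) = 0 := by
  rw [Matrix.mul_apply]
  exact Finset.sum_eq_zero fun k _ => by rw [shift_apply, if_neg (by simp), mul_zero]

theorem shift_mul_of_lt {r q : ℕ} {ι : Type*} (M : Matrix (Fin q × Fin r) ι ℂ) (x : ι) {j : ℕ}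
    (hj : j + 1 < q) (b : Fin r) :
    (scalarToeplitz r q PowerSeries.X * M) (⟨j, by omega⟩, b) x = M (⟨j + 1, hj⟩, b) x := by
  rw [Matrix.mul_apply, Finset.sum_eq_single (⟨j + 1, hj⟩, b)]
  · simp [shift_apply]
  · rintro ⟨k, c⟩ - hne
    rw [shift_apply, if_neg, zero_mul]
    rintro ⟨h1, h2⟩
    simp only at h1 h2
    exact hne (Prod.ext (Fin.ext (by simp only; omega)) h2.symm)
  · simp

/-- The blocks in the first row of `M`. -/
def rowSymbol {r q : ℕ} (M : Matrix (Fin q × Fin r) (Fin q × Fin r) ℂ) (k : ℕ) :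
    Matrix (Fin r) (Fin r) ℂ :=
  Matrix.of fun a b => if h : k < q then M (⟨0, by omega⟩, a) (⟨k, h⟩, b) else 0

theorem rowSymbol_toeplitz {r q : ℕ} (h : ℕ → Matrix (Fin r) (Fin r) ℂ) {k : ℕ} (hk : k < q) :
    rowSymbol (toeplitz r q h) k = h k := by
  ext a b
  simp only [rowSymbol, Matrix.of_apply, dif_pos hk, toeplitz_zero_apply]

/-- Comparing entries of `ΛM = MΛ` shows that blocks are constant along diagonals and that column
zero vanishes below row zero. Induction on the row then carries everything back to row zero. -/
theorem eq_toeplitz_of_commute {r q : ℕ} {M : Matrix (Fin q × Fin r) (Fin q × Fin r) ℂ}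
    (h : Commute M (scalarToeplitz r q PowerSeries.X)) : M = toeplitz r q (rowSymbol M) := by
  have key : ∀ (i : ℕ) (hi : i < q) (j : ℕ) (hj : j < q) (a b : Fin r),
      M (⟨i, hi⟩, a) (⟨j, hj⟩, b) = if i ≤ j then rowSymbol M (j - i) a b else 0 := by
    intro i
    induction i with
    | zero =>
      intro hi j hj a b
      simp [rowSymbol, hj]
    | succ i ih =>
      intro hi j hj a b
      rw [← shift_mul_of_lt M _ hi, ← h.eq]
      rcases j with _ | j
      · rw [mul_shift_zero]
        simp
      · rw [mul_shift_succ, ih]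
        simp
  ext ⟨i, a⟩ ⟨j, b⟩
  exact key i i.2 j j.2 a b

theorem commute_toeplitz_scalarToeplitz (r q : ℕ) (h : ℕ → Matrix (Fin r) (Fin r) ℂ)
    (F : PowerSeries ℂ) : Commute (toeplitz r q h) (scalarToeplitz r q F) := by
  rw [← toeplitzHom_mk]
  refine Commute.map ?_ (toeplitzHom r q)
  ext1 k
  rw [PowerSeries.coeff_mul, PowerSeries.coeff_mul, ← Finset.Nat.sum_antidiagonal_swap]
  refine Finset.sum_congr rfl fun x _ => ?_
  simp only [Prod.fst_swap, Prod.snd_swap, PowerSeries.coeff_map]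
  exact (Matrix.scalar_commute _ (fun r' => Commute.all _ _) _).symm.eq

/-- The point is that the leading block is automatically invertible: `g⁻¹` commutes with the shift
too, so it is Toeplitz, and the leading blocks of `g` and `g⁻¹` multiply to `1`. -/
theorem mem_jordanGroup_iff {r q : ℕ} (hq : 0 < q) {g : GL (Fin q × Fin r) ℂ} :
    g ∈ jordanGroup r q ↔
      Commute (g : Matrix (Fin q × Fin r) (Fin q × Fin r) ℂ)
        (scalarToeplitz r q PowerSeries.X) := by
  constructor
  · rintro ⟨h, -, hg⟩
    rw [hg]
    exact commute_toeplitz_scalarToeplitz r q h _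
  · intro hc
    have h1 := eq_toeplitz_of_commute hc
    have h2 := eq_toeplitz_of_commute 
      (M := ((g⁻¹ : GL (Fin q × Fin r) ℂ) : Matrix (Fin q × Fin r) (Fin q × Fin r) ℂ))
      (Commute.units_inv_left hc)
    refine ⟨_, ?_, h1⟩
    have h3 := Units.mul_inv g
    rw [h1, h2, ← toeplitzHom_mk, ← toeplitzHom_mk, ← map_mul, ← map_one (toeplitzHom r q)] at h3
    rw [toeplitzHom_apply, toeplitzHom_apply] at h3
    have h4 := toeplitz_injOn h3 hq
    simp only [PowerSeries.coeff_mul, Finset.Nat.antidiagonal_zero, Finset.sum_singleton,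
      PowerSeries.coeff_mk, PowerSeries.coeff_one, if_true] at h4
    exact (Matrix.isUnit_iff_isUnit_det _).2 (Matrix.isUnit_det_of_right_inverse h4)

/-- Two families of test elements suffice: `1 + Λ` forces `M` to be Toeplitz, and constant
transvections force each block of its symbol to be scalar. -/
theorem eq_scalarToeplitz_of_commute {r q : ℕ}
    {M : Matrix (Fin q × Fin r) (Fin q × Fin r) ℂ}
    (h : ∀ g ∈ jordanGroup r q, Commute (g : Matrix (Fin q × Fin r) (Fin q × Fin r) ℂ) M) :
    ∃ F : PowerSeries ℂ, M = scalarToeplitz r q F := by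
  have hmem : ∀ F : PowerSeries (Matrix (Fin r) (Fin r) ℂ), IsUnit F →
      Commute (toeplitzHom r q F) M := by
    intro F hF
    obtain ⟨u, hu⟩ := hF.map (toeplitzHom r q)
    rw [← hu]
    refine h u ⟨fun k => PowerSeries.coeff k F, ?_, hu⟩
    beta_reduce
    rw [PowerSeries.coeff_zero_eq_constantCoeff_apply]
    exact hF.map (PowerSeries.constantCoeff (R := Matrix (Fin r) (Fin r) ℂ))
  have hX : Commute M (scalarToeplitz r q PowerSeries.X) := by
    have h1 : IsUnit (1 + PowerSeries.X : PowerSeries ℂ) := by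
      rw [PowerSeries.isUnit_iff_constantCoeff]
      simp
    have h2 := hmem _ (h1.map (PowerSeries.map (Matrix.scalar (Fin r))))
    rw [map_add, map_add, map_one, map_one] at h2
    have h3 := h2.sub_left (Commute.one_left M)
    rw [add_sub_cancel_left] at h3
    exact h3.symm
  have hM := eq_toeplitz_of_commute hX
  have hs : ∀ k < q, ∃ c : ℂ, Matrix.scalar (Fin r) c = rowSymbol M k := by
    intro k hk
    refine Matrix.mem_range_scalar_of_commute_transvectionStruct fun t => ?_
    have ht : IsUnit t.toMatrix :=
      (Matrix.isUnit_iff_isUnit_det _).2 (by simp)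
    have h1 := hmem (PowerSeries.C t.toMatrix) (ht.map _)
    rw [hM, ← toeplitzHom_mk] at h1
    have h2 := h1.eq
    rw [← map_mul, ← map_mul] at h2
    rw [toeplitzHom_apply, toeplitzHom_apply] at h2
    have h3 := toeplitz_injOn h2 hk
    simpa [Commute, SemiconjBy] using h3
  choose! c hc using hs
  refine ⟨PowerSeries.mk c, ?_⟩
  refine hM.trans ?_
  rw [scalarToeplitz, RingHom.comp_apply, toeplitzHom_apply]
  refine toeplitz_congr fun k hk => ?_
  rw [PowerSeries.coeff_map, PowerSeries.coeff_mk, hc k hk]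

/-! ### The matrices `μ(c)` intertwine the shift with its conjugates -/

/-- Row `i` of `μ(c)` lists the coefficients of `M(c, T)^i`. The shift on the left replaces this row
by the next one, and `M(c, Λ)` on the right multiplies it by `M(c, T)`: both give `M(c, T)^(i+1)`.
-/
theorem shift_mul_muMatrix {r q : ℕ} (c : ℕ → ℂ) :
    scalarToeplitz r q PowerSeries.X * (muMatrix q c ⊗ₖ (1 : Matrix (Fin r) (Fin r) ℂ)) =
      (muMatrix q c ⊗ₖ (1 : Matrix (Fin r) (Fin r) ℂ)) * scalarToeplitz r q (genSeries c) := by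
  have row : ∀ (G : PowerSeries ℂ) (j : Fin q),
      ∑ k : Fin q, PowerSeries.coeff k G * PowerSeries.coeff j (PowerSeries.X ^ (k : ℕ) * genSeries c)
        = PowerSeries.coeff j (G * genSeries c) := by
    intro G j
    rw [Fin.sum_univ_eq_sum_range (fun k => PowerSeries.coeff k G *
      PowerSeries.coeff j (PowerSeries.X ^ k * genSeries c)), PowerSeries.coeff_mul,
      Finset.Nat.sum_antidiagonal_eq_sum_range_succ
        (fun a b => PowerSeries.coeff a G * PowerSeries.coeff b (genSeries c))]
    symm
    have hj := j.2
    rw [← Finset.sum_subset (s₁ := Finset.range ((j : ℕ) + 1)) (s₂ := Finset.range q)]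
    · refine Finset.sum_congr rfl fun k hk => ?_
      rw [PowerSeries.coeff_X_pow_mul', if_pos (by simp at hk; omega)]
    · intro k hk
      simp at hk ⊢
      omega
    · intro k _ hk
      rw [PowerSeries.coeff_X_pow_mul', if_neg (by simp at hk; omega), mul_zero]
  ext ⟨i, a⟩ ⟨j, b⟩
  have hR : ((muMatrix q c ⊗ₖ (1 : Matrix (Fin r) (Fin r) ℂ)) * scalarToeplitz r q (genSeries c))
      (i, a) (j, b) = if a = b then mu c (i + 1) j else 0 := by
    rw [Matrix.mul_apply, Fintype.sum_prod_type_right, Finset.sum_eq_single a]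
    · by_cases hab : a = b
      · simp [Matrix.kroneckerMap_apply, scalarToeplitz_apply, hab, muMatrix, mu, row, pow_succ]
      · simp [scalarToeplitz_apply, hab]
    · intro k _ hk
      exact Finset.sum_eq_zero fun x _ => by
        simp [Matrix.kroneckerMap_apply, Matrix.one_apply_ne hk.symm]
    · simp
  rw [hR]
  by_cases hi : (i : ℕ) + 1 < q
  · have := shift_mul_of_lt (muMatrix q c ⊗ₖ (1 : Matrix (Fin r) (Fin r) ℂ)) (j, b) hi a
    rw [Fin.eta] at this
    rw [this]
    simp [Matrix.kroneckerMap_apply, muMatrix, Matrix.one_apply]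
  -- In the last row the shift produces zero, which agrees with `M(c, T)^q` having no term of degree
  -- below `q`.
  · have hj := j.2
    rw [mu_of_lt c (show (j : ℕ) < (i : ℕ) + 1 by omega), ite_self, Matrix.mul_apply]
    refine Finset.sum_eq_zero fun k _ => ?_
    rw [shift_apply, if_neg, zero_mul]
    rintro ⟨h, -⟩
    have := k.1.2
    simp only at h
    omega

theorem exists_wGroup_coe (r q : ℕ) {c : ℕ → ℂ} (hc : c 1 ≠ 0) :
    ∃ w ∈ wGroup r q, (w : Matrix (Fin q × Fin r) (Fin q × Fin r) ℂ) =
      muMatrix q c ⊗ₖ (1 : Matrix (Fin r) (Fin r) ℂ) := by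
  have h : IsUnit (muMatrix q c ⊗ₖ (1 : Matrix (Fin r) (Fin r) ℂ)) := by
    rw [Matrix.isUnit_iff_isUnit_det, Matrix.det_kronecker]
    have := (Matrix.isUnit_iff_isUnit_det _).1 (isUnit_muMatrix q hc)
    simpa using this.pow _
  obtain ⟨u, hu⟩ := h
  exact ⟨u, ⟨c, hc, hu⟩, hu⟩

/-- Since `w⁻¹ Λ w = M(c, Λ)` is a scalar series in `Λ`, it commutes with `h`; conjugating by `w`,
the shift commutes with `w h w⁻¹`. -/
theorem conj_mem_jordanGroup {r q : ℕ} {w h : GL (Fin q × Fin r) ℂ}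
    (hw : w ∈ wGroup r q) (hh : h ∈ jordanGroup r q) : w * h * w⁻¹ ∈ jordanGroup r q := by
  rcases Nat.eq_zero_or_pos q with rfl | hq
  · rwa [Subsingleton.elim (w * h * w⁻¹) h]
  rw [mem_jordanGroup_iff hq]
  obtain ⟨c, -, hc⟩ := hw
  obtain ⟨f, -, hf⟩ := hh
  have h1 := shift_mul_muMatrix (r := r) (q := q) c
  rw [← hc] at h1
  have h2 := (commute_toeplitz_scalarToeplitz r q f (genSeries c)).eq
  rw [← hf] at h2
  have h3 : ((w⁻¹ : GL (Fin q × Fin r) ℂ) : Matrix (Fin q × Fin r) (Fin q × Fin r) ℂ) *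
      scalarToeplitz r q PowerSeries.X =
      scalarToeplitz r q (genSeries c) * (w⁻¹ : GL (Fin q × Fin r) ℂ) := by
    rw [Units.inv_mul_eq_iff_eq_mul, ← mul_assoc, ← h1, mul_assoc, Units.mul_inv, mul_one]
  rw [Units.val_mul, Units.val_mul, Commute, SemiconjBy, mul_assoc, h3, ← mul_assoc,
    mul_assoc w.val, h2, ← mul_assoc, ← h1]
  simp only [mul_assoc]

/-- Row zero of `μ(c)` holds the coefficients of `M(c, T)^0 = 1`, and a Toeplitz matrix is
determined by its row zero. -/
theorem eq_one_of_mem_wGroup_of_mem_jordanGroup {r q : ℕ} {w : GL (Fin q × Fin r) ℂ}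
    (hw : w ∈ wGroup r q) (hj : w ∈ jordanGroup r q) : w = 1 := by
  obtain ⟨c, -, hc⟩ := hw
  obtain ⟨h, -, hh⟩ := hj
  ext1
  rw [hh, Units.val_one, ← toeplitz_one r q]
  refine toeplitz_congr fun k hk => ?_
  ext a b
  rw [← toeplitz_zero_apply h hk, ← hh, hc, Matrix.kroneckerMap_apply]
  by_cases h0 : k = 0
  · simp [muMatrix, mu, PowerSeries.coeff_one, h0]
  · simp [muMatrix, mu, PowerSeries.coeff_one, h0]

/-- Because row zero of `w` is that of the identity, the factor `j` of a product `w * j` with `j ∈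
J_r(q)` can be read off from row zero. This makes the factorization continuous later on. -/
theorem rowSymbol_wGroup_mul {r q : ℕ} {w : GL (Fin q × Fin r) ℂ} (hw : w ∈ wGroup r q)
    (M : Matrix (Fin q × Fin r) (Fin q × Fin r) ℂ) :
    rowSymbol ((w : Matrix (Fin q × Fin r) (Fin q × Fin r) ℂ) * M) = rowSymbol M := by
  obtain ⟨c, -, hc⟩ := hw
  ext k a b
  simp only [rowSymbol, Matrix.of_apply]
  split_ifs with hk
  · rw [hc, Matrix.mul_apply, Finset.sum_eq_single (⟨0, by omega⟩, a)]
    · simp [Matrix.kroneckerMap_apply, muMatrix, mu]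
    · rintro ⟨i, d⟩ - hne
      by_cases hi : (i : ℕ) = 0
      · have hd : a ≠ d := fun e => hne (Prod.ext (Fin.ext hi) e.symm)
        simp [Matrix.kroneckerMap_apply, Matrix.one_apply_ne hd]
      · simp [Matrix.kroneckerMap_apply, muMatrix, mu, PowerSeries.coeff_one, hi]
    · simp
  · rfl

/-- An automorphism of the algebra generated by the shift is substitution in power series. -/
theorem exists_wGroup_mul_jordanGroup {r q : ℕ} (hr : 0 < r) (hq : 0 < q)
    (u : GL (Fin q × Fin r) ℂ) (F : PowerSeries ℂ)
    (h : (u : Matrix (Fin q × Fin r) (Fin q × Fin r) ℂ) * scalarToeplitz r q PowerSeries.X =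
      scalarToeplitz r q F * u) :
    ∃ w ∈ wGroup r q, ∃ j ∈ jordanGroup r q, u = w * j := by
  -- Conjugation by `u` takes `Λ ^ m` to `F(Λ) ^ m`, so `Λ` and `F(Λ)` have the same nilpotency
  -- index.
  have hpow : ∀ m : ℕ, PowerSeries.X ^ q ∣ F ^ m ↔
      PowerSeries.X ^ q ∣ (PowerSeries.X : PowerSeries ℂ) ^ m := by
    intro m
    have h1 : (u : Matrix (Fin q × Fin r) (Fin q × Fin r) ℂ) *
        scalarToeplitz r q (PowerSeries.X ^ m) = scalarToeplitz r q (F ^ m) * u := by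
      rw [map_pow, map_pow]
      exact (SemiconjBy.pow_right h m)
    rw [← scalarToeplitz_eq_zero_iff hr, ← scalarToeplitz_eq_zero_iff hr]
    constructor
    · intro h2
      rw [h2, zero_mul] at h1
      exact (Units.mul_right_eq_zero u).1 h1
    · intro h2
      rw [h2, mul_zero] at h1
      exact (Units.mul_left_eq_zero u).1 h1.symm
  have hX : PowerSeries.X ∣ F :=
    PowerSeries.X_prime.dvd_of_dvd_pow ((dvd_pow_self _ hq.ne').trans ((hpow q).2 dvd_rfl))
  have hF0 : PowerSeries.coeff 0 F = 0 := by
    rw [PowerSeries.coeff_zero_eq_constantCoeff_apply]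
    exact PowerSeries.X_dvd_iff.1 hX
  have hF1 : 2 ≤ q → PowerSeries.coeff 1 F ≠ 0 := by
    intro hq2 h1
    have h2 : PowerSeries.X ^ 2 ∣ F := by
      rw [PowerSeries.X_pow_dvd_iff]
      intro m hm
      interval_cases m
      · exact hF0
      · exact h1
    -- If `F` had order at least two, then `2 (q - 1) ≥ q` would give `F(Λ)^(q-1) = 0`, whereas
    -- `Λ^(q-1) ≠ 0`.
    have h3 : PowerSeries.X ^ q ∣ F ^ (q - 1) := by
      refine (pow_dvd_pow _ ?_).trans ((pow_mul _ 2 (q - 1)).dvd.trans (pow_dvd_pow_of_dvd h2 _))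
      omega
    have h4 := PowerSeries.X_pow_dvd_iff.1 ((hpow (q - 1)).1 h3) (q - 1) (by omega)
    simp at h4
  obtain ⟨c, hc, hcF⟩ : ∃ c : ℕ → ℂ, c 1 ≠ 0 ∧
      scalarToeplitz r q (genSeries c) = scalarToeplitz r q F := by
    rcases Nat.lt_or_ge q 2 with h2 | h2
    -- Here `q = 1`: only constant terms matter, and any `c` with `c 1 ≠ 0` serves.
    · refine ⟨fun _ => 1, one_ne_zero, scalarToeplitz_eq_of_dvd hr ?_⟩
      rw [PowerSeries.X_pow_dvd_iff]
      intro m hm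
      obtain rfl : m = 0 := by omega
      rw [map_sub, hF0, sub_zero, PowerSeries.coeff_zero_eq_constantCoeff_apply,
        constantCoeff_genSeries]
    · refine ⟨fun k => PowerSeries.coeff k F, hF1 h2, congrArg _ ?_⟩
      ext k
      by_cases hk : k = 0
      · simp [genSeries, hk, hF0]
      · simp [genSeries, hk]
  obtain ⟨w, hw, hwc⟩ := exists_wGroup_coe r q hc
  -- The two conjugations cancel: `u` takes `Λ` to `F(Λ)` and `w` takes `F(Λ)` back to `Λ`, so `w *
  -- u` centralizes the shift.
  refine ⟨w⁻¹, inv_mem hw, w * u, ?_, by group⟩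
  rw [mem_jordanGroup_iff hq, Commute, SemiconjBy, Units.val_mul, mul_assoc, h, ← hcF, ← mul_assoc,
    hwc, ← shift_mul_muMatrix, mul_assoc]

end WeylJordan

namespace WeylJordan

variable {r s : ℕ} {n p : Fin s → ℕ}

/-! ### Block diagonal matrices -/

theorem coe_blockDiag (X : ∀ b : Blk p, GL (Fin (n b.1) × Fin r) ℂ) :
    (blockDiag r n p X : Matrix (Idx r n p) (Idx r n p) ℂ) =
      Matrix.blockDiagonal' fun b => (X b : Matrix (Fin (n b.1) × Fin r) (Fin (n b.1) × Fin r) ℂ) :=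
  rfl

theorem blockDiag_injective : Function.Injective (blockDiag r n p) := by
  intro X Y h
  have h1 := congrArg (fun g : GL (Idx r n p) ℂ => (g : Matrix (Idx r n p) (Idx r n p) ℂ)) h
  simp only [coe_blockDiag] at h1
  have h2 := Matrix.blockDiagonal'_injective h1
  funext b
  exact Units.ext (congrFun h2 b)

theorem mem_hGroup_iff {g : GL (Idx r n p) ℂ} :
    g ∈ hGroup r n p ↔ ∃ h : ∀ b : Blk p, GL (Fin (n b.1) × Fin r) ℂ,
      (∀ b, h b ∈ jordanGroup r (n b.1)) ∧ blockDiag r n p h = g := by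
  simp [hGroup, Subgroup.mem_map, Subgroup.mem_pi]

theorem eq_blockDiagonal' {M : Matrix (Idx r n p) (Idx r n p) ℂ}
    (h : ∀ x y, x.1 ≠ y.1 → M x y = 0) : M = Matrix.blockDiagonal' (Matrix.blockDiag' M) := by
  ext ⟨b, u⟩ ⟨b', v⟩
  by_cases hb : b = b'
  · subst hb
    rw [Matrix.blockDiagonal'_apply_eq]
    rfl
  · rw [Matrix.blockDiagonal'_apply_ne _ _ _ hb, h _ _ hb]

theorem exists_eq_blockDiag {g : GL (Idx r n p) ℂ}
    (h : ∀ x y, x.1 ≠ y.1 → (g : Matrix (Idx r n p) (Idx r n p) ℂ) x y = 0)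
    (h' : ∀ x y, x.1 ≠ y.1 → (↑g⁻¹ : Matrix (Idx r n p) (Idx r n p) ℂ) x y = 0) :
    ∃ X : ∀ b : Blk p, GL (Fin (n b.1) × Fin r) ℂ, g = blockDiag r n p X := by
  have h1 := eq_blockDiagonal' h
  have h2 := eq_blockDiagonal' h'
  have h3 := Units.mul_inv g
  have h4 := Units.inv_mul g
  rw [h1, h2, ← Matrix.blockDiagonal'_mul, ← Matrix.blockDiagonal'_one] at h3 h4
  have h5 := Matrix.blockDiagonal'_injective h3
  have h6 := Matrix.blockDiagonal'_injective h4
  refine ⟨fun b => ⟨_, _, congrFun h5 b, congrFun h6 b⟩, Units.ext ?_⟩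
  rw [coe_blockDiag]
  exact h1

/-- The matrix `diag(F_b(Λ))_b` attached to a family of scalar power series. -/
noncomputable def scalarBlocks (r : ℕ) (n p : Fin s → ℕ) :
    (Blk p → PowerSeries ℂ) →+* Matrix (Idx r n p) (Idx r n p) ℂ :=
  (Matrix.blockDiagonal'RingHom (fun b : Blk p => Fin (n b.1) × Fin r) ℂ).comp
    (RingHom.pi fun b => (scalarToeplitz r (n b.1)).comp (Pi.evalRingHom _ b))

theorem scalarBlocks_apply (F : Blk p → PowerSeries ℂ) :
    scalarBlocks r n p F = Matrix.blockDiagonal' fun b => scalarToeplitz r (n b.1) (F b) := rfl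

theorem scalarBlocks_eq_iff {F G : Blk p → PowerSeries ℂ} :
    scalarBlocks r n p F = scalarBlocks r n p G ↔
      ∀ b, scalarToeplitz r (n b.1) (F b) = scalarToeplitz r (n b.1) (G b) := by
  rw [scalarBlocks_apply, scalarBlocks_apply, Matrix.blockDiagonal'_inj, funext_iff]

theorem scalarBlocks_single (b : Blk p) :
    scalarBlocks r n p (Pi.single b 1) = Matrix.diagonal fun x => if x.1 = b then 1 else 0 := by
  have h : (fun c => scalarToeplitz r (n c.1) ((Pi.single b 1 : Blk p → PowerSeries ℂ) c)) =
      fun c => Matrix.diagonal fun _ : Fin (n c.1) × Fin r => if c = b then (1 : ℂ) else 0 := by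
    funext c
    by_cases hc : c = b
    · subst hc
      simp
    · simp [hc]
  rw [scalarBlocks_apply, h, Matrix.blockDiagonal'_diagonal]

theorem apply_eq_zero_of_commute_single {M : Matrix (Idx r n p) (Idx r n p) ℂ}
    (h : ∀ b, Commute M (scalarBlocks r n p (Pi.single b 1))) (x y : Idx r n p)
    (hxy : x.1 ≠ y.1) : M x y = 0 := by
  have h1 := congrFun (congrFun (h y.1).eq x) y
  simpa [scalarBlocks_single, Matrix.mul_diagonal, Matrix.diagonal_mul, hxy] using h1

theorem scalarBlocks_mem_hGroup {F : Blk p → PowerSeries ℂ} (hF : ∀ b, IsUnit (F b)) :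
    ∃ h ∈ hGroup r n p, (h : Matrix (Idx r n p) (Idx r n p) ℂ) = scalarBlocks r n p F := by
  choose u hu using fun b : Blk p => (hF b).map (scalarToeplitz r (n b.1))
  refine ⟨_, mem_hGroup_iff.2 ⟨u, fun b => ?_, rfl⟩, ?_⟩
  · refine ⟨fun k => PowerSeries.coeff k (PowerSeries.map (Matrix.scalar (Fin r)) (F b)), ?_, ?_⟩
    swap
    · rw [hu b]
      rfl
    beta_reduce
    rw [PowerSeries.coeff_zero_eq_constantCoeff_apply]
    exact ((hF b).map _).map (PowerSeries.constantCoeff (R := Matrix (Fin r) (Fin r) ℂ))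
  · rw [coe_blockDiag, scalarBlocks_apply]
    simp only [hu]

/-- The commutant of `H_λ` in the matrix algebra. -/
theorem forall_commute_hGroup_iff {M : Matrix (Idx r n p) (Idx r n p) ℂ} :
    (∀ h ∈ hGroup r n p, Commute (h : Matrix (Idx r n p) (Idx r n p) ℂ) M) ↔
      ∃ F, M = scalarBlocks r n p F := by
  constructor
  · intro h
    have hs : ∀ b, Commute M (scalarBlocks r n p (Pi.single b 1)) := by
      intro b
      -- The block idempotent is not invertible, but adding `1` gives constant terms `1` or `2`,
      -- hence an element of `H_λ` to test against.
      have hu : ∀ c, IsUnit ((1 + Pi.single b 1 : Blk p → PowerSeries ℂ) c) := by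
        intro c
        rw [PowerSeries.isUnit_iff_constantCoeff]
        by_cases hc : c = b
        · subst hc
          simp only [Pi.add_apply, Pi.one_apply, Pi.single_eq_same, map_add, map_one]
          norm_num
        · simp [hc]
      obtain ⟨g, hg, hgu⟩ := scalarBlocks_mem_hGroup (r := r) (n := n) hu
      have h1 := h g hg
      rw [hgu, map_add, map_one] at h1
      have h2 := h1.sub_left (Commute.one_left M)
      rw [add_sub_cancel_left] at h2
      exact h2.symm
    have hM := eq_blockDiagonal' (apply_eq_zero_of_commute_single hs)
    have hb : ∀ b, ∃ F, Matrix.blockDiag' M b = scalarToeplitz r (n b.1) F := by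
      intro b
      refine eq_scalarToeplitz_of_commute fun g hg => ?_
      have h1 := h _ (mem_hGroup_iff.2 ⟨Pi.mulSingle b g, fun c => ?_, rfl⟩)
      · rw [hM, coe_blockDiag, Commute, SemiconjBy, ← Matrix.blockDiagonal'_mul,
          ← Matrix.blockDiagonal'_mul, Matrix.blockDiagonal'_inj] at h1
        simpa [Commute, SemiconjBy] using congrFun h1 b
      · by_cases hc : c = b
        · subst hc
          simpa using hg
        · simp [hc]
    choose F hF using hb
    refine ⟨F, hM.trans ?_⟩
    rw [scalarBlocks_apply]
    exact congrArg _ (funext hF)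
  · rintro ⟨F, rfl⟩ h hh
    obtain ⟨f, hf, rfl⟩ := mem_hGroup_iff.1 hh
    rw [coe_blockDiag, scalarBlocks_apply, Commute, SemiconjBy, ← Matrix.blockDiagonal'_mul,
      ← Matrix.blockDiagonal'_mul, Matrix.blockDiagonal'_inj]
    funext b
    obtain ⟨t, -, ht⟩ := hf b
    rw [ht]
    exact (commute_toeplitz_scalarToeplitz r _ t (F b)).eq

/-- For `x` in the commutant, `g⁻¹ x g` commutes with `h` because `x` commutes with `g h g⁻¹ ∈ H_λ`.
The inclusion `g H_λ g⁻¹ ⊆ H_λ` is enough. -/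
theorem inv_mul_scalarBlocks {g : GL (Idx r n p) ℂ}
    (hg : ∀ h ∈ hGroup r n p, g * h * g⁻¹ ∈ hGroup r n p) (F : Blk p → PowerSeries ℂ) :
    ∃ F', ((g⁻¹ : GL (Idx r n p) ℂ) : Matrix (Idx r n p) (Idx r n p) ℂ) * scalarBlocks r n p F =
      scalarBlocks r n p F' * (g⁻¹ : GL (Idx r n p) ℂ) := by
  obtain ⟨F', hF'⟩ := forall_commute_hGroup_iff (r := r) (n := n) (p := p)
    (M := g⁻¹.val * scalarBlocks r n p F * g.val) |>.1 (by
      intro h hh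
      have h1 := (forall_commute_hGroup_iff.2 ⟨F, rfl⟩ _ (hg h hh)).eq
      rw [Units.val_mul, Units.val_mul] at h1
      have h2 : g.val * (h.val * (g⁻¹.val * scalarBlocks r n p F)) =
          scalarBlocks r n p F * (g.val * (h.val * g⁻¹.val)) := by
        simpa only [mul_assoc] using h1
      rw [← Units.eq_inv_mul_iff_mul_eq] at h2
      rw [Commute, SemiconjBy]
      calc h.val * (g⁻¹.val * scalarBlocks r n p F * g.val)
          = (h.val * (g⁻¹.val * scalarBlocks r n p F)) * g.val := by simp only [mul_assoc]
        _ = g⁻¹.val * scalarBlocks r n p F * g.val * h.val := by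
          rw [h2]
          simp only [mul_assoc, Units.inv_mul, mul_one])
  refine ⟨F', ?_⟩
  rw [← hF', mul_assoc, Units.mul_inv, mul_one]

/-! ### Conjugation permutes the blocks -/

/-- The conjugates `E b` of the block idempotents are orthogonal idempotents with sum `1`, and each
component is `0` or `1` by locality. So each block `c` carries exactly one nonzero `E b`, with `b =
β c`; no `E b` vanishes, so `β` is onto, hence bijective, and `τ = β⁻¹`. -/
theorem exists_perm_of_mul_scalarBlocks (hr : 0 < r) (hn : ∀ i, 0 < n i) {k : GL (Idx r n p) ℂ}
    (hk : ∀ F, ∃ F', (k : Matrix (Idx r n p) (Idx r n p) ℂ) * scalarBlocks r n p F =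
      scalarBlocks r n p F' * k) :
    ∃ τ : Equiv.Perm (Blk p), (∀ b, (k : Matrix (Idx r n p) (Idx r n p) ℂ) *
      scalarBlocks r n p (Pi.single b 1) = scalarBlocks r n p (Pi.single (τ b) 1) * k) ∧
      ∀ b, n (τ b).1 = n b.1 := by
  classical
  have hne : ∀ b : Blk p, Nontrivial
      (Matrix (Fin (n b.1) × Fin r) (Fin (n b.1) × Fin r) ℂ) := by
    intro b
    have : Nonempty (Fin (n b.1) × Fin r) := ⟨(⟨0, hn _⟩, ⟨0, hr⟩)⟩
    infer_instance
  choose E hE using fun b : Blk p => hk (Pi.single b 1)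
  have hE' : ∀ b, scalarBlocks r n p (E b) =
      k.val * scalarBlocks r n p (Pi.single b 1) * k⁻¹.val := by
    intro b
    rw [hE, mul_assoc, Units.mul_inv, mul_one]
  have hmul : ∀ b b', scalarBlocks r n p (E b * E b') =
      k.val * scalarBlocks r n p (Pi.single b 1 * Pi.single b' 1) * k⁻¹.val := by
    intro b b'
    rw [map_mul, map_mul, hE', hE']
    simp only [mul_assoc, Units.inv_mul_cancel_left]
  have h01 : ∀ b c, scalarToeplitz r (n c.1) (E b c) = 0 ∨ scalarToeplitz r (n c.1) (E b c) = 1 := by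
    intro b c
    refine scalarToeplitz_idempotent hr ?_
    have h1 := hmul b b
    rw [← Pi.single_mul, one_mul, ← hE', scalarBlocks_eq_iff] at h1
    rw [← map_mul]
    exact h1 c
  have horth : ∀ b b' c, b ≠ b' →
      scalarToeplitz r (n c.1) (E b c) * scalarToeplitz r (n c.1) (E b' c) = 0 := by
    intro b b' c hbb
    have h0 : (Pi.single b 1 * Pi.single b' 1 : Blk p → PowerSeries ℂ) = 0 := by
      ext1 d
      by_cases hd : d = b
      · subst hd
        simp [hbb]
      · simp [hd]
    have h1 := hmul b b'
    rw [h0, map_zero, mul_zero, zero_mul, ← map_zero (scalarBlocks r n p),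
      scalarBlocks_eq_iff] at h1
    simpa using h1 c
  have hsum : ∀ c, ∑ b, scalarToeplitz r (n c.1) (E b c) = 1 := by
    intro c
    have h0 : ∑ b, (Pi.single b 1 : Blk p → PowerSeries ℂ) = 1 := by
      ext1 d
      simp [Finset.sum_apply, Pi.single_apply]
    have h1 : scalarBlocks r n p (∑ b, E b) = 1 := by
      rw [map_sum, Finset.sum_congr rfl fun b _ => hE' b, ← Finset.sum_mul, ← Finset.mul_sum,
        ← map_sum, h0, map_one, mul_one, Units.mul_inv]
    rw [← map_one (scalarBlocks r n p), scalarBlocks_eq_iff] at h1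
    have h2 := h1 c
    rwa [Finset.sum_apply, map_sum, Pi.one_apply, map_one] at h2
  have hex : ∀ c, ∃ b, scalarToeplitz r (n c.1) (E b c) = 1 := by
    intro c
    by_contra! h
    have h1 := hsum c
    rw [Finset.sum_eq_zero fun b _ => (h01 b c).resolve_right (h b)] at h1
    have := hne c
    exact zero_ne_one h1
  choose β hβ using hex
  have hβu : ∀ b c, scalarToeplitz r (n c.1) (E b c) = if b = β c then 1 else 0 := by
    intro b c
    split_ifs with h
    · rw [h, hβ]
    · have h1 := horth b (β c) c h
      rwa [hβ, mul_one] at h1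
  have hsurj : Function.Surjective β := by
    intro b
    by_contra! h
    have h1 : scalarBlocks r n p (E b) = scalarBlocks r n p 0 := by
      rw [scalarBlocks_eq_iff]
      intro c
      rw [hβu, if_neg (h c).symm, Pi.zero_apply, map_zero]
    rw [hE', map_zero, Units.mul_left_eq_zero, Units.mul_right_eq_zero,
      ← map_zero (scalarBlocks r n p), scalarBlocks_eq_iff] at h1
    have h2 := h1 b
    rw [Pi.single_eq_same, map_one, Pi.zero_apply, map_zero] at h2
    have := hne b
    exact one_ne_zero h2
  let τ : Equiv.Perm (Blk p) := (Equiv.ofBijective β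
    (Finite.surjective_iff_bijective.1 hsurj)).symm
  have hτ : ∀ b, scalarBlocks r n p (E b) = scalarBlocks r n p (Pi.single (τ b) 1) := by
    intro b
    rw [scalarBlocks_eq_iff]
    intro c
    have hc : b = β c ↔ c = τ b :=
      eq_comm.trans (Equiv.eq_symm_apply (Equiv.ofBijective β _)).symm
    rw [hβu]
    by_cases h : c = τ b
    · rw [if_pos (hc.2 h), h, Pi.single_eq_same, map_one]
    · rw [if_neg (mt hc.1 h), Pi.single_eq_of_ne h, map_zero]
  refine ⟨τ, fun b => by rw [hE, hτ], fun b => ?_⟩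
  -- The trace of an idempotent recovers the block size and is invariant under conjugation.
  have htr : ∀ b, Matrix.trace (scalarBlocks r n p (Pi.single b 1)) = ((n b.1 * r : ℕ) : ℂ) := by
    intro b
    rw [scalarBlocks_apply, Matrix.trace_blockDiagonal', Finset.sum_eq_single b]
    · rw [Pi.single_eq_same, map_one, Matrix.trace_one]
      simp
    · intro c _ hc
      rw [Pi.single_eq_of_ne hc, map_zero, Matrix.trace_zero]
    · simp
  have h1 := htr (τ b)
  rw [← hτ, hE', Matrix.trace_mul_cycle, Units.inv_mul, one_mul, htr] at h1
  exact (Nat.eq_of_mul_eq_mul_right hr (by exact_mod_cast h1)).symm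

theorem exists_sigma_perm {τ : Equiv.Perm (Blk p)} (h : ∀ b, (τ b).1 = b.1) :
    ∃ σ : ∀ i, Equiv.Perm (Fin (p i)), ∀ b, τ b = ⟨b.1, σ b.1 b.2⟩ := by
  have h1 : ∀ (i : Fin s) (k : Fin (p i)), ∃ k', τ ⟨i, k⟩ = ⟨i, k'⟩ := by
    intro i k
    have := h ⟨i, k⟩
    generalize τ ⟨i, k⟩ = c at this
    obtain ⟨j, l⟩ := c
    simp only at this
    subst this
    exact ⟨l, rfl⟩
  choose f hf using h1
  have hinj : ∀ i, Function.Injective (f i) := by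
    intro i k l hkl
    have h2 : τ ⟨i, k⟩ = τ ⟨i, l⟩ := by rw [hf, hf, hkl]
    simpa using τ.injective h2
  exact ⟨fun i => Equiv.ofBijective (f i) (Finite.injective_iff_bijective.1 (hinj i)),
    fun b => hf b.1 b.2⟩

/-! ### Block permutation matrices -/

theorem permGL_apply (σ : ∀ i, Equiv.Perm (Fin (p i))) (x y : Idx r n p) :
    (permGL r n p σ : Matrix (Idx r n p) (Idx r n p) ℂ) x y =
      if x = ⟨⟨y.1.1, σ y.1.1 y.1.2⟩, y.2⟩ then 1 else 0 := rfl

theorem mul_permGL_apply (σ : ∀ i, Equiv.Perm (Fin (p i))) (M : Matrix (Idx r n p) (Idx r n p) ℂ)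
    (x y : Idx r n p) :
    (M * (permGL r n p σ : Matrix (Idx r n p) (Idx r n p) ℂ)) x y =
      M x ⟨⟨y.1.1, σ y.1.1 y.1.2⟩, y.2⟩ := by
  simp [Matrix.mul_apply, permGL_apply]

theorem permGL_mul_apply (σ : ∀ i, Equiv.Perm (Fin (p i))) (M : Matrix (Idx r n p) (Idx r n p) ℂ)
    (x y : Idx r n p) :
    ((permGL r n p σ : Matrix (Idx r n p) (Idx r n p) ℂ) * M) ⟨⟨x.1.1, σ x.1.1 x.1.2⟩, x.2⟩ y =
      M x y := by
  rw [Matrix.mul_apply, Finset.sum_eq_single x]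
  · rw [permGL_apply, if_pos rfl, one_mul]
  · rintro ⟨⟨i, k⟩, u⟩ - hne
    rw [permGL_apply, if_neg, zero_mul]
    obtain ⟨⟨j, l⟩, v⟩ := x
    intro h
    apply hne
    obtain rfl : j = i := congrArg (fun z : Idx r n p => z.1.1) h
    simp only [Sigma.mk.injEq, heq_eq_eq, true_and, EmbeddingLike.apply_eq_iff_eq] at h
    obtain ⟨rfl, h2⟩ := h
    rw [h2]
  · simp

theorem permGL_mul_blockDiagonal' (σ : ∀ i, Equiv.Perm (Fin (p i)))
    {A A' : ∀ b : Blk p, Matrix (Fin (n b.1) × Fin r) (Fin (n b.1) × Fin r) ℂ}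
    (h : ∀ i k, A' ⟨i, σ i k⟩ = A ⟨i, k⟩) :
    (permGL r n p σ : Matrix (Idx r n p) (Idx r n p) ℂ) * Matrix.blockDiagonal' A =
      Matrix.blockDiagonal' A' * (permGL r n p σ : Matrix (Idx r n p) (Idx r n p) ℂ) := by
  ext ⟨⟨i, k⟩, u⟩ ⟨⟨j, l⟩, v⟩
  obtain ⟨k, rfl⟩ := (σ i).surjective k
  rw [mul_permGL_apply]
  refine (permGL_mul_apply σ (Matrix.blockDiagonal' A) ⟨⟨i, k⟩, u⟩ _).trans ?_
  by_cases hb : (⟨i, k⟩ : Blk p) = ⟨j, l⟩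
  · obtain ⟨rfl, hkl⟩ := Sigma.mk.inj hb
    obtain rfl := eq_of_heq hkl
    refine (Matrix.blockDiagonal'_apply_eq A _ _ _).trans ?_
    refine Eq.trans ?_ (Matrix.blockDiagonal'_apply_eq A' _ _ _).symm
    rw [h]
  · refine (Matrix.blockDiagonal'_apply_ne A _ _ hb).trans ?_
    refine (Matrix.blockDiagonal'_apply_ne A' _ _ fun e => hb ?_).symm
    obtain ⟨rfl, hkl⟩ := Sigma.mk.inj e
    rw [(σ i).injective (eq_of_heq hkl)]

theorem permGL_mul_blockDiag (σ : ∀ i, Equiv.Perm (Fin (p i)))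
    (X : ∀ b : Blk p, GL (Fin (n b.1) × Fin r) ℂ) :
    permGL r n p σ * blockDiag r n p X =
      blockDiag r n p (fun b => X ⟨b.1, (σ b.1)⁻¹ b.2⟩) * permGL r n p σ := by
  ext1
  rw [Units.val_mul, Units.val_mul, coe_blockDiag, coe_blockDiag]
  refine permGL_mul_blockDiagonal' σ fun i k => ?_
  have h : (σ i)⁻¹ (σ i k) = k := (σ i).symm_apply_apply k
  exact congrArg (fun l : Fin (p i) => (show GL (Fin (n i) × Fin r) ℂ from X ⟨i, l⟩).val) h

theorem permGL_mul_single (σ : ∀ i, Equiv.Perm (Fin (p i))) (b : Blk p) :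
    (permGL r n p σ : Matrix (Idx r n p) (Idx r n p) ℂ) * scalarBlocks r n p (Pi.single b 1) =
      scalarBlocks r n p (Pi.single ⟨b.1, σ b.1 b.2⟩ 1) * permGL r n p σ := by
  rw [scalarBlocks_apply, scalarBlocks_apply]
  refine permGL_mul_blockDiagonal' σ fun i k => congrArg _ ?_
  obtain ⟨j, l⟩ := b
  have hiff : (⟨i, σ i k⟩ : Blk p) = ⟨j, σ j l⟩ ↔ (⟨i, k⟩ : Blk p) = ⟨j, l⟩ := by
    constructor
    · intro h
      obtain ⟨rfl, hkl⟩ := Sigma.mk.inj h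
      rw [(σ i).injective (eq_of_heq hkl)]
    · intro h
      obtain ⟨rfl, hkl⟩ := Sigma.mk.inj h
      rw [eq_of_heq hkl]
  by_cases h : (⟨i, k⟩ : Blk p) = ⟨j, l⟩
  · simp only [Pi.single_apply, if_pos h, if_pos (hiff.2 h)]
  · simp only [Pi.single_apply, if_neg h, if_neg (mt hiff.1 h)]

/-! ### The normalizer of `H_λ` -/

theorem permGL_conj_mem (σ : ∀ i, Equiv.Perm (Fin (p i))) {h : GL (Idx r n p) ℂ}
    (hh : h ∈ hGroup r n p) : permGL r n p σ * h * (permGL r n p σ)⁻¹ ∈ hGroup r n p := by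
  obtain ⟨f, hf, rfl⟩ := mem_hGroup_iff.1 hh
  rw [permGL_mul_blockDiag, mul_inv_cancel_right]
  exact mem_hGroup_iff.2 ⟨_, fun b => hf ⟨b.1, (σ b.1)⁻¹ b.2⟩, rfl⟩

theorem blockDiag_conj_mem {X : ∀ b : Blk p, GL (Fin (n b.1) × Fin r) ℂ}
    (hX : ∀ b, X b ∈ wGroup r (n b.1)) {h : GL (Idx r n p) ℂ} (hh : h ∈ hGroup r n p) :
    blockDiag r n p X * h * (blockDiag r n p X)⁻¹ ∈ hGroup r n p := by
  obtain ⟨f, hf, rfl⟩ := mem_hGroup_iff.1 hh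
  rw [← map_inv, ← map_mul, ← map_mul]
  exact mem_hGroup_iff.2 ⟨_, fun b => conj_mem_jordanGroup (hX b) (hf b), rfl⟩

theorem permGL_mem_hNormalizer (σ : ∀ i, Equiv.Perm (Fin (p i))) :
    permGL r n p σ ∈ hNormalizer r n p := by
  rw [Subgroup.mem_normalizer_iff]
  refine fun h => ⟨permGL_conj_mem σ, fun hh => ?_⟩
  have h1 := permGL_conj_mem σ⁻¹ hh
  rw [map_inv] at h1
  simpa [mul_assoc] using h1

theorem blockDiag_mem_hNormalizer {X : ∀ b : Blk p, GL (Fin (n b.1) × Fin r) ℂ}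
    (hX : ∀ b, X b ∈ wGroup r (n b.1)) : blockDiag r n p X ∈ hNormalizer r n p := by
  rw [Subgroup.mem_normalizer_iff]
  refine fun h => ⟨blockDiag_conj_mem hX, fun hh => ?_⟩
  have h1 := blockDiag_conj_mem (X := X⁻¹) (fun b => inv_mem (hX b)) hh
  rw [map_inv] at h1
  simpa [mul_assoc] using h1

theorem toGL_mem_hNormalizer (X : WProd r n p) (σ : ∀ i, Equiv.Perm (Fin (p i))) :
    toGL r n p X σ ∈ hNormalizer r n p :=
  mul_mem (blockDiag_mem_hNormalizer fun b => (X b.1 b.2).2) (permGL_mem_hNormalizer σ)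

theorem toGL_mul (X Y : WProd r n p) (σ τ : ∀ i, Equiv.Perm (Fin (p i))) :
    toGL r n p X σ * toGL r n p Y τ = toGL r n p (X * permAction r n p σ Y) (σ * τ) := by
  have h : blockDiag r n p (fun b => ((X * permAction r n p σ Y) b.1 b.2 :
        GL (Fin (n b.1) × Fin r) ℂ)) = blockDiag r n p (fun b => (X b.1 b.2 : GL _ ℂ)) *
        blockDiag r n p (fun b => (Y b.1 ((σ b.1)⁻¹ b.2) : GL _ ℂ)) := by
    rw [← map_mul]
    rfl
  rw [toGL, toGL, toGL, h, map_mul, mul_assoc, ← mul_assoc (permGL r n p σ), permGL_mul_blockDiag]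
  simp only [mul_assoc]

/-- If `g` conjugates `H_λ` into itself, then `g⁻¹` is a product of a block permutation matrix,
an element of `∏_i W_r(n_i)^{p_i}` and an element of `H_λ`. -/
theorem exists_eq_toGL_mul (hr : 0 < r) (hn : Function.Injective n) (hn_pos : ∀ i, 0 < n i)
    {g : GL (Idx r n p) ℂ} (hg : ∀ h ∈ hGroup r n p, g * h * g⁻¹ ∈ hGroup r n p) :
    ∃ X σ, ∃ h ∈ hGroup r n p, g⁻¹ = toGL r n p X σ * h := by
  obtain ⟨τ, hτ, hτn⟩ := exists_perm_of_mul_scalarBlocks hr hn_pos (inv_mul_scalarBlocks hg)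
  obtain ⟨σ, hσ⟩ := exists_sigma_perm fun b => hn (hτn b)
  -- Removing the permutation makes `k` commute with every block idempotent, so `k` is block
  -- diagonal. Moreover `k⁻¹ = g P_σ` still conjugates `H_λ` into itself.
  set k : GL (Idx r n p) ℂ := (permGL r n p σ)⁻¹ * g⁻¹ with hk
  have hkg : k⁻¹ = g * permGL r n p σ := by rw [hk]; group
  have hkc : ∀ b, Commute (k : Matrix (Idx r n p) (Idx r n p) ℂ)
      (scalarBlocks r n p (Pi.single b 1)) := by
    intro b
    have h1 := hτ b
    rw [hσ] at h1
    rw [hk, Units.val_mul, Commute, SemiconjBy, mul_assoc, h1, ← mul_assoc, ← mul_assoc]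
    congr 1
    rw [Units.inv_mul_eq_iff_eq_mul, ← mul_assoc, permGL_mul_single, mul_assoc, Units.mul_inv,
      mul_one]
  obtain ⟨U, hU⟩ := exists_eq_blockDiag (apply_eq_zero_of_commute_single hkc)
    (apply_eq_zero_of_commute_single fun b => (hkc b).units_inv_left)
  have hstab : ∀ h ∈ hGroup r n p, k⁻¹ * h * k⁻¹⁻¹ ∈ hGroup r n p := by
    intro h hh
    have h1 := hg _ (permGL_conj_mem σ hh)
    rw [hkg]
    simpa [mul_assoc] using h1
  -- Taking the shift in all blocks at once yields the relation `U_b Λ = F_b(Λ) U_b` in each block.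
  obtain ⟨F, hF⟩ := inv_mul_scalarBlocks hstab fun _ => PowerSeries.X
  rw [inv_inv, hU, coe_blockDiag, scalarBlocks_apply, scalarBlocks_apply,
    ← Matrix.blockDiagonal'_mul, ← Matrix.blockDiagonal'_mul, Matrix.blockDiagonal'_inj] at hF
  choose w hw j hj hwj using fun b : Blk p =>
    exists_wGroup_mul_jordanGroup hr (hn_pos b.1) (U b) (F b) (congrFun hF b)
  -- The permutation stands to the left of `diag(w)`; moving it to the right permutes the blocks of
  -- `w`.
  refine ⟨permAction r n p σ fun i k => ⟨w ⟨i, k⟩, hw ⟨i, k⟩⟩, σ, _,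
    mem_hGroup_iff.2 ⟨j, hj, rfl⟩, ?_⟩
  have h1 : g⁻¹ = permGL r n p σ * k := by rw [hk]; group
  rw [h1, hU, toGL, funext hwj]
  change permGL r n p σ * blockDiag r n p (w * j) = _
  rw [map_mul, ← mul_assoc, permGL_mul_blockDiag]
  rfl

/-- For the nontrivial inclusion, the one-sided condition already factors `g⁻¹` into elements that
normalize `H_λ`. -/
theorem hNormalizer_eq (hr : 0 < r) (hn : Function.Injective n) (hn_pos : ∀ i, 0 < n i) :
    (hNormalizer r n p : Set (GL (Idx r n p) ℂ)) =
      {g | ∀ h ∈ hGroup r n p, g * h * g⁻¹ ∈ hGroup r n p} := by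
  ext g
  constructor
  · exact fun hg h hh => (Subgroup.mem_normalizer_iff.1 hg h).1 hh
  · intro hg
    obtain ⟨X, σ, h, hh, e⟩ := exists_eq_toGL_mul hr hn hn_pos hg
    rw [← inv_inv g, e]
    exact inv_mem (mul_mem (toGL_mem_hNormalizer X σ) (Subgroup.le_normalizer hh))

theorem exists_eq_toGL_mul_of_mem (hr : 0 < r) (hn : Function.Injective n) (hn_pos : ∀ i, 0 < n i)
    {g : GL (Idx r n p) ℂ} (hg : g ∈ hNormalizer r n p) :
    ∃ X σ, ∃ h ∈ hGroup r n p, g = toGL r n p X σ * h := by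
  have h1 := exists_eq_toGL_mul hr hn hn_pos (g := g⁻¹)
    fun h hh => (Subgroup.mem_normalizer_iff.1 (inv_mem hg) h).1 hh
  rwa [inv_inv] at h1

/-- A block moved by `σ` would put an entry `1` of `P_σ` outside the diagonal blocks, although `P_σ`
would be block diagonal. With `σ = 1`, the claim reduces blockwise to the trivial intersection of
`W_r(q)` and `J_r(q)`. -/
theorem eq_one_of_toGL_mem_hGroup (hr : 0 < r) (hn_pos : ∀ i, 0 < n i) {X : WProd r n p}
    {σ : ∀ i, Equiv.Perm (Fin (p i))} (h : toGL r n p X σ ∈ hGroup r n p) : X = 1 ∧ σ = 1 := by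
  obtain ⟨f, hf, he⟩ := mem_hGroup_iff.1 h
  have hσ : σ = 1 := by
    ext1 i
    ext1 k
    by_contra hne
    have h1 : permGL r n p σ =
        blockDiag r n p ((fun b : Blk p => (X b.1 b.2 : GL (Fin (n b.1) × Fin r) ℂ))⁻¹ * f) := by
      rw [map_mul, he, map_inv, toGL, inv_mul_cancel_left]
    have h2 : (permGL r n p σ : Matrix (Idx r n p) (Idx r n p) ℂ)
        ⟨⟨i, σ i k⟩, (⟨0, hn_pos i⟩, ⟨0, hr⟩)⟩ ⟨⟨i, k⟩, (⟨0, hn_pos i⟩, ⟨0, hr⟩)⟩ = 1 := by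
      rw [permGL_apply, if_pos rfl]
    rw [h1, coe_blockDiag, Matrix.blockDiagonal'_apply_ne] at h2
    · exact zero_ne_one h2
    · intro e
      exact hne (eq_of_heq (Sigma.mk.inj e).2)
  refine ⟨?_, hσ⟩
  rw [toGL, hσ, map_one, mul_one] at he
  have h1 := blockDiag_injective he
  ext1 i
  ext1 k
  refine Subtype.ext (eq_one_of_mem_wGroup_of_mem_jordanGroup (X i k).2 ?_)
  have h2 := congrFun h1 ⟨i, k⟩
  simp only at h2
  rw [← h2]
  exact hf ⟨i, k⟩

/-! ### The isomorphisms with the Weyl group -/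

/-- `(X, σ) ↦ diag(X) P_σ`, with values in the normalizer. -/
noncomputable def toNormalizer (r : ℕ) (n p : Fin s → ℕ) :
    WProd r n p ⋊[permAction r n p] (∀ i, Equiv.Perm (Fin (p i))) →* hNormalizer r n p where
  toFun x := ⟨toGL r n p x.left x.right, toGL_mem_hNormalizer _ _⟩
  map_one' := by
    refine Subtype.ext ?_
    change blockDiag r n p 1 * permGL r n p 1 = 1
    rw [map_one, map_one, one_mul]
  map_mul' x y := Subtype.ext (toGL_mul x.left y.left x.right y.right).symm

/-- The semidirect product `∏_i W_r(n_i)^{p_i} ⋊ ∏_i 𝔖_{p_i}` is isomorphic to `W_λ`. -/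
noncomputable def semidirectEquiv (hr : 0 < r) (hn : Function.Injective n)
    (hn_pos : ∀ i, 0 < n i) :
    WProd r n p ⋊[permAction r n p] (∀ i, Equiv.Perm (Fin (p i))) ≃* weylGroup r n p :=
  MulEquiv.ofBijective ((QuotientGroup.mk' _).comp (toNormalizer r n p)) <| by
    constructor
    · rw [injective_iff_map_eq_one]
      intro x hx
      have h1 := (QuotientGroup.eq_one_iff _).1 hx
      rw [Subgroup.mem_subgroupOf] at h1
      obtain ⟨h2, h3⟩ := eq_one_of_toGL_mem_hGroup hr hn_pos h1
      exact SemidirectProduct.ext h2 h3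
    · intro y
      obtain ⟨g, rfl⟩ := QuotientGroup.mk_surjective y
      obtain ⟨X, σ, h, hh, e⟩ := exists_eq_toGL_mul_of_mem hr hn hn_pos g.2
      refine ⟨⟨X, σ⟩, ?_⟩
      refine QuotientGroup.eq.2 ?_
      rw [Subgroup.mem_subgroupOf]
      change (toGL r n p X σ)⁻¹ * (g : GL (Idx r n p) ℂ) ∈ _
      rw [e, inv_mul_cancel_left]
      exact hh

/-- Regrouping the product of the groups `W_r(n_i)^{p_i} ⋊ 𝔖_{p_i}`. -/
def wreathEquiv (r : ℕ) (n p : Fin s → ℕ) : (∀ i, WreathW r (n i) (p i)) ≃*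
    WProd r n p ⋊[permAction r n p] (∀ i, Equiv.Perm (Fin (p i))) where
  toFun x := ⟨fun i => (x i).left, fun i => (x i).right⟩
  invFun x i := ⟨x.left i, x.right i⟩
  left_inv _ := rfl
  right_inv _ := rfl
  map_mul' _ _ := rfl

end WeylJordan

namespace WeylJordan

/-! ### Topology of `W_r(q)` -/

theorem mu_succ (c : ℕ → ℂ) (i j : ℕ) :
    mu c (i + 1) j = ∑ x ∈ Finset.HasAntidiagonal.antidiagonal j, mu c i x.1 * mu c 1 x.2 := by
  simp [mu, pow_succ, PowerSeries.coeff_mul]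

theorem continuous_mu {Y : Type*} [TopologicalSpace Y] {f : Y → ℕ → ℂ}
    (hf : ∀ k, Continuous fun y => f y k) (i j : ℕ) : Continuous fun y => mu (f y) i j := by
  induction i generalizing j with
  | zero => simp [mu, continuous_const]
  | succ i ih =>
    simp only [mu_succ _ i, mu_one]
    refine continuous_finsetSum _ fun x _ => (ih _).mul ?_
    split_ifs
    · exact continuous_const
    · exact hf _

theorem differentiable_mu {V : Type*} [NormedAddCommGroup V] [NormedSpace ℂ V] {f : V → ℕ → ℂ}
    (hf : ∀ k, Differentiable ℂ fun v => f v k) (i j : ℕ) :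
    Differentiable ℂ fun v => mu (f v) i j := by
  induction i generalizing j with
  | zero => simp [mu]
  | succ i ih =>
    simp only [mu_succ _ i, mu_one]
    refine Differentiable.fun_sum fun x _ => (ih _).mul ?_
    split_ifs
    · exact differentiable_const _
    · exact hf _

theorem continuous_matrix_inv {Y m : Type*} [TopologicalSpace Y] [Fintype m] [DecidableEq m]
    {f : Y → Matrix m m ℂ} (hf : Continuous f) (hu : ∀ y, IsUnit (f y)) :
    Continuous fun y => (f y)⁻¹ := by
  rw [continuous_iff_continuousAt]
  intro y
  have h : ContinuousAt Ring.inverse (f y).det := by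
    rw [Ring.inverse_eq_inv']
    exact continuousAt_inv₀ ((Matrix.isUnit_iff_isUnit_det _).1 (hu y)).ne_zero
  exact (continuousAt_matrix_inv (f y) h).comp hf.continuousAt

theorem continuous_GL_of_val {Y m : Type*} [TopologicalSpace Y] [Fintype m] [DecidableEq m]
    {f : Y → GL m ℂ} (hf : Continuous fun y => (f y : Matrix m m ℂ)) : Continuous f := by
  rw [Units.continuous_iff]
  refine ⟨hf, ?_⟩
  simp only [Matrix.coe_units_inv]
  exact continuous_matrix_inv hf fun y => (f y).isUnit

instance connectedSpace_wGroup (r q : ℕ) : ConnectedSpace (wGroup r q) := by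
  have h0 : ConnectedSpace {z : ℂ // z ≠ 0} := by
    refine Subtype.connectedSpace (s := {z : ℂ | z ≠ 0}) ?_
    exact isConnected_compl_singleton_of_one_lt_rank
      (by rw [Complex.rank_real_complex]; exact Cardinal.one_lt_two) 0
  -- The parameter space is the connected product `ℂ^× × ℂ^ℕ`; the first factor overwrites the
  -- coordinate `c 1`.
  choose w hw hwc using fun x : {z : ℂ // z ≠ 0} × (ℕ → ℂ) =>
    exists_wGroup_coe r q (c := Function.update x.2 1 x.1) (by simpa using x.1.2)
  refine Function.Surjective.connectedSpace (f := fun x => (⟨w x, hw x⟩ : wGroup r q)) ?_ ?_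
  · rintro ⟨g, c, hc, hg⟩
    refine ⟨(⟨c 1, hc⟩, c), Subtype.ext (Units.ext ?_)⟩
    simp only [hwc, Function.update_eq_self]
    exact hg.symm
  · refine Continuous.subtype_mk (continuous_GL_of_val ?_) _
    simp only [hwc]
    refine continuous_matrix fun x y => ?_
    simp only [Matrix.kroneckerMap_apply, muMatrix, Matrix.of_apply]
    refine (continuous_mu (fun k => ?_) _ _).mul continuous_const
    have hc : Continuous fun x : {z : ℂ // z ≠ 0} × (ℕ → ℂ) =>
        Function.update x.2 1 (x.1 : ℂ) :=
      continuous_snd.update 1 (continuous_subtype_val.comp continuous_fst)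
    exact (continuous_pi_iff.1 hc) k

variable {r s : ℕ} {n p : Fin s → ℕ}

/-! ### The open embedding into the Weyl group -/

theorem toGL_one (X : WProd r n p) : toGL r n p X 1 =
    blockDiag r n p fun b => (X b.1 b.2 : GL (Fin (n b.1) × Fin r) ℂ) := by
  rw [toGL, map_one, mul_one]

theorem continuous_toNormalizer_inl :
    Continuous fun X : WProd r n p => toNormalizer r n p (SemidirectProduct.inl X) := by
  refine Continuous.subtype_mk (f := fun X : WProd r n p => toGL r n p X 1)
    (continuous_GL_of_val ?_) _
  simp only [toGL_one, coe_blockDiag]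
  refine Continuous.matrix_blockDiagonal' (continuous_pi fun b => ?_)
  exact Units.continuous_val.comp (continuous_subtype_val.comp
    ((continuous_apply b.2).comp (continuous_apply b.1)))

/-- Nonvanishing of all diagonal blocks is an open condition; it isolates the identity permutation
within the normalizer. -/
theorem eq_one_of_diagonal_blocks_ne_zero {X : WProd r n p} {σ : ∀ i, Equiv.Perm (Fin (p i))}
    {h : GL (Idx r n p) ℂ} (hh : h ∈ hGroup r n p)
    (hne : ∀ b : Blk p, ∃ u v, (toGL r n p X σ * h : GL (Idx r n p) ℂ).val ⟨b, u⟩ ⟨b, v⟩ ≠ 0) :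
    σ = 1 := by
  obtain ⟨f, -, rfl⟩ := mem_hGroup_iff.1 hh
  ext1 i
  ext1 k
  by_contra hk
  obtain ⟨u, v, huv⟩ := hne ⟨i, k⟩
  rw [toGL, mul_assoc, permGL_mul_blockDiag, ← mul_assoc, ← map_mul, Units.val_mul,
    mul_permGL_apply, coe_blockDiag] at huv
  refine huv (Matrix.blockDiagonal'_apply_ne _ _ _ fun e => hk ?_)
  exact (eq_of_heq (Sigma.mk.inj e).2).symm

/-- On the open set `S` of normalizer elements with nonzero diagonal blocks, the `W`-component is a
continuous function `ρ`. The image of an open `U` is the projection of `ρ ⁻¹' U`, and the quotient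
map is open. -/
theorem isOpenEmbedding_semidirectEquiv_inl (hr : 0 < r) (hn : Function.Injective n)
    (hn_pos : ∀ i, 0 < n i) : Topology.IsOpenEmbedding fun X : WProd r n p =>
      semidirectEquiv hr hn hn_pos (SemidirectProduct.inl X) := by
  have hinj : Function.Injective fun X : WProd r n p =>
      semidirectEquiv hr hn hn_pos (SemidirectProduct.inl X) :=
    (semidirectEquiv hr hn hn_pos).injective.comp SemidirectProduct.inl_injective
  refine .of_continuous_injective_isOpenMap
    (QuotientGroup.continuous_mk.comp continuous_toNormalizer_inl) hinj ?_
  have hval : Continuous fun g : hNormalizer r n p => (g : GL (Idx r n p) ℂ).val :=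
    Units.continuous_val.comp continuous_subtype_val
  set S : Set (hNormalizer r n p) :=
    {g | ∀ b : Blk p, ∃ u v, (g : GL (Idx r n p) ℂ).val ⟨b, u⟩ ⟨b, v⟩ ≠ 0} with hS
  have hSo : IsOpen S := by
    simp only [hS, Set.ofPred_forall, Set.ofPred_exists]
    refine isOpen_iInter_of_finite fun b => isOpen_iUnion fun u => isOpen_iUnion fun v => ?_
    exact isOpen_ne_fun (hval.matrix_elem _ _) continuous_const
  have hex : ∀ g : S, ∃ X : WProd r n p, ∃ f : ∀ b : Blk p, GL (Fin (n b.1) × Fin r) ℂ,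
      (∀ b, f b ∈ jordanGroup r (n b.1)) ∧
      (g : GL (Idx r n p) ℂ) = toGL r n p X 1 * blockDiag r n p f := by
    intro g
    obtain ⟨X, σ, h, hh, e⟩ := exists_eq_toGL_mul_of_mem hr hn hn_pos g.1.2
    have hg := g.2
    simp only [hS, Set.mem_ofPred_eq] at hg
    rw [e] at hg
    obtain rfl := eq_one_of_diagonal_blocks_ne_zero hh hg
    obtain ⟨f, hf, rfl⟩ := mem_hGroup_iff.1 hh
    exact ⟨X, f, hf, e⟩
  choose ρ f hf hρ using hex
  have hmk : ∀ g : S, semidirectEquiv hr hn hn_pos (SemidirectProduct.inl (ρ g)) =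
      QuotientGroup.mk g.1 := by
    intro g
    refine QuotientGroup.eq.2 ?_
    rw [Subgroup.mem_subgroupOf]
    change (toGL r n p (ρ g) 1)⁻¹ * (g : GL (Idx r n p) ℂ) ∈ _
    rw [hρ, inv_mul_cancel_left]
    exact mem_hGroup_iff.2 ⟨f g, hf g, rfl⟩
  have hblock : ∀ (g : S) (b : Blk p),
      Matrix.blockDiag' (g : GL (Idx r n p) ℂ).val b = (ρ g b.1 b.2).1.val * (f g b).val := by
    intro g b
    rw [hρ, toGL_one, ← map_mul, coe_blockDiag, Matrix.blockDiag'_blockDiagonal']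
    rfl
  -- The Jordan factor depends continuously on `g`, being built from row zero of the diagonal block;
  -- the `W`-factor is then the block times its inverse.
  have hrow : ∀ (g : S) (b : Blk p), (f g b).val =
      toeplitz r (n b.1) (rowSymbol (Matrix.blockDiag' (g : GL (Idx r n p) ℂ).val b)) := by
    intro g b
    rw [hblock, rowSymbol_wGroup_mul (ρ g b.1 b.2).2]
    obtain ⟨t, -, ht⟩ := hf g b
    rw [ht]
    exact toeplitz_congr fun k hk => (rowSymbol_toeplitz t hk).symm
  have hρc : Continuous ρ := by
    refine continuous_pi fun i => continuous_pi fun k => ?_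
    refine continuous_induced_rng.2 (continuous_GL_of_val ?_)
    have hb : Continuous fun g : S => Matrix.blockDiag' (g : GL (Idx r n p) ℂ).val ⟨i, k⟩ :=
      continuous_matrix fun u v => (hval.comp continuous_subtype_val).matrix_elem _ _
    have hfc : Continuous fun g : S => (f g ⟨i, k⟩).val := by
      simp only [hrow]
      refine continuous_matrix fun x y => ?_
      simp only [toeplitz, rowSymbol, Matrix.of_apply]
      split_ifs
      · exact hb.matrix_elem _ _
      · exact continuous_const
      · exact continuous_const
    have he : ∀ g : S, (ρ g i k).1.val =
        Matrix.blockDiag' (g : GL (Idx r n p) ℂ).val ⟨i, k⟩ * (f g ⟨i, k⟩).val⁻¹ := by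
      intro g
      rw [hblock, Matrix.mul_nonsing_inv_cancel_right]
      exact (Matrix.isUnit_iff_isUnit_det _).1 (f g ⟨i, k⟩).isUnit
    refine Continuous.congr ?_ fun g => (he g).symm
    exact hb.matrix_mul (continuous_matrix_inv hfc fun g => (f g ⟨i, k⟩).isUnit)
  intro U hU
  have himage : (fun X : WProd r n p => semidirectEquiv hr hn hn_pos (SemidirectProduct.inl X)) '' U
      = QuotientGroup.mk '' (Subtype.val '' (ρ ⁻¹' U)) := by
    ext y
    constructor
    · rintro ⟨X, hX, rfl⟩
      have hmem : toNormalizer r n p (SemidirectProduct.inl X) ∈ S := by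
        intro b
        by_contra! h
        have h1 : (X b.1 b.2).1.val = 0 := by
          ext u v
          have h2 := h u v
          change (toGL r n p X 1).val _ _ = 0 at h2
          rwa [toGL_one, coe_blockDiag, Matrix.blockDiagonal'_apply_eq] at h2
        have : Nonempty (Fin (n b.1) × Fin r) := ⟨(⟨0, hn_pos _⟩, ⟨0, hr⟩)⟩
        exact (X b.1 b.2).1.ne_zero h1
      refine ⟨_, ⟨⟨_, hmem⟩, ?_, rfl⟩, rfl⟩
      have h1 : ρ ⟨_, hmem⟩ = X := hinj (hmk ⟨_, hmem⟩)
      rwa [Set.mem_preimage, h1]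
    · rintro ⟨_, ⟨g, hg, rfl⟩, rfl⟩
      exact ⟨ρ g, hg, hmk g⟩
  rw [himage]
  exact QuotientGroup.isOpenMap_coe _ (hSo.isOpenMap_subtype_val _ (hU.preimage hρc))

/-! ### The submanifold of block diagonal matrices -/

/-- The image of an open set under a holomorphic map with a linear left inverse. -/
theorem isComplexSubmanifold_image {E V : Type*} [NormedAddCommGroup E] [NormedSpace ℂ E]
    [NormedAddCommGroup V] [NormedSpace ℂ V] [FiniteDimensional ℂ V] (L : E →L[ℂ] V)
    (J : V →L[ℂ] E) (F : V → E) (hJ : ∀ v, L (J v) = v) (hF : ∀ v, L (F v) = v)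
    (hFd : Differentiable ℂ F) {Ω : Set V} (hΩ : IsOpen Ω) :
    IsComplexSubmanifold (F '' Ω) (Module.finrank ℂ V) := by
  have hd : Differentiable ℂ fun x => x - F (L x) + J (L x) :=
    (differentiable_id.sub (hFd.comp L.differentiable)).add (J.differentiable.comp L.differentiable)
  have hd' : Differentiable ℂ fun x => x + F (L x) - J (L x) :=
    (differentiable_id.add (hFd.comp L.differentiable)).sub (J.differentiable.comp L.differentiable)
  have hL : ∀ x, L (x - F (L x) + J (L x)) = L x := by simp [hF, hJ]
  have hL' : ∀ x, L (x + F (L x) - J (L x)) = L x := by simp [hF, hJ]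
  -- A shear along the fibres of `L`: it leaves `L x` unchanged, so its inverse is explicit, and it
  -- takes the graph point `F v` to `J v` in a linear subspace.
  let φ : OpenPartialHomeomorph E E :=
    { toFun := fun x => x - F (L x) + J (L x)
      invFun := fun x => x + F (L x) - J (L x)
      source := L ⁻¹' Ω
      target := L ⁻¹' Ω
      map_source' := fun x hx => by rwa [Set.mem_preimage, hL]
      map_target' := fun x hx => by rwa [Set.mem_preimage, hL']
      left_inv' := fun x _ => by
        rw [hL]
        abel
      right_inv' := fun x _ => by
        rw [hL']
        abel
      open_source := hΩ.preimage L.continuous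
      open_target := hΩ.preimage L.continuous
      continuousOn_toFun := hd.continuous.continuousOn
      continuousOn_invFun := hd'.continuous.continuousOn }
  have hinj : Function.Injective (J : V →ₗ[ℂ] E) := Function.LeftInverse.injective (g := L) hJ
  rintro _ ⟨v, hv, rfl⟩
  refine ⟨φ, LinearMap.range (J : V →ₗ[ℂ] E), ?_, hd.differentiableOn, hd'.differentiableOn,
    inferInstance, LinearMap.finrank_range_of_inj hinj, ?_⟩
  · change L (F v) ∈ Ω
    rwa [hF]
  · ext y
    constructor
    · rintro ⟨_, ⟨-, w, hw, rfl⟩, rfl⟩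
      have h1 : φ (F w) = J w := by
        change F w - F (L (F w)) + J (L (F w)) = J w
        rw [hF, sub_self, zero_add]
      rw [h1]
      refine ⟨?_, w, rfl⟩
      change L (J w) ∈ Ω
      rwa [hJ]
    · rintro ⟨hy, w, rfl⟩
      change L (J w) ∈ Ω at hy
      rw [hJ] at hy
      refine ⟨F w, ⟨?_, w, hy, rfl⟩, ?_⟩
      · change L (F w) ∈ Ω
        rwa [hF]
      · change F w - F (L (F w)) + J (L (F w)) = J w
        rw [hF, sub_self, zero_add]

/-- The index set of the parameters `c_{b,1}, …, c_{b,n_b-1}`. -/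
abbrev Param (n p : Fin s → ℕ) : Type := (b : Blk p) × Fin (n b.1 - 1)

/-- The sequence of parameters of the block `b`. -/
def paramSeq (c : Param n p → ℂ) (b : Blk p) (k : ℕ) : ℂ :=
  if h : 0 < k ∧ k < n b.1 then c ⟨b, ⟨k - 1, by omega⟩⟩ else 0

theorem paramSeq_succ (c : Param n p → ℂ) (b : Blk p) (j : Fin (n b.1 - 1)) :
    paramSeq c b (j + 1) = c ⟨b, j⟩ := by
  have := j.2
  rw [paramSeq, dif_pos ⟨Nat.succ_pos _, by omega⟩]
  rfl

/-- The parametrization `c ↦ diag(μ(c_b) ⊗ 1_r)_b`. -/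
noncomputable def paramMatrix (r : ℕ) (n p : Fin s → ℕ) (c : Param n p → ℂ) :
    Idx r n p → Idx r n p → ℂ :=
  Matrix.blockDiagonal' fun b : Blk p =>
    muMatrix (n b.1) (paramSeq c b) ⊗ₖ (1 : Matrix (Fin r) (Fin r) ℂ)

theorem differentiable_paramMatrix : Differentiable ℂ (paramMatrix r n p) := by
  refine differentiable_pi.2 fun x => differentiable_pi.2 fun y => ?_
  obtain ⟨b, u⟩ := x
  obtain ⟨b', v⟩ := y
  by_cases hb : b = b'
  · subst hb
    simp only [paramMatrix, Matrix.blockDiagonal'_apply_eq, Matrix.kroneckerMap_apply, muMatrix,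
      Matrix.of_apply]
    refine (differentiable_mu (fun k => ?_) _ _).mul (differentiable_const _)
    simp only [paramSeq]
    split_ifs
    · exact differentiable_apply _
    · exact differentiable_const _
  · simp only [paramMatrix, Matrix.blockDiagonal'_apply_ne _ _ _ hb]
    exact differentiable_const _

/-- The matrix entry that holds a given parameter. -/
def paramEntry (hr : 0 < r) (κ : Param n p) : Idx r n p × Idx r n p :=
  (⟨κ.1, (⟨1, by have := κ.2.2; omega⟩, ⟨0, hr⟩)⟩,
    ⟨κ.1, (⟨κ.2 + 1, by have := κ.2.2; omega⟩, ⟨0, hr⟩)⟩)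

theorem paramEntry_injective (hr : 0 < r) :
    Function.Injective (paramEntry hr : Param n p → _) := by
  rintro ⟨b, j⟩ ⟨b', j'⟩ h
  have h2 := congrArg Prod.snd h
  obtain ⟨rfl, h3⟩ := Sigma.mk.inj h2
  have h4 := congrArg (fun z => (z.1 : ℕ)) (eq_of_heq h3)
  simp only [Nat.add_right_cancel_iff] at h4
  rw [Fin.ext h4]

theorem paramMatrix_paramEntry (hr : 0 < r) (c : Param n p → ℂ) (κ : Param n p) :
    paramMatrix r n p c (paramEntry hr κ).1 (paramEntry hr κ).2 = c κ := by
  simp only [paramMatrix, paramEntry, Matrix.blockDiagonal'_apply_eq, Matrix.kroneckerMap_apply,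
    muMatrix, Matrix.of_apply, mu_one, Matrix.one_apply_eq, mul_one]
  rw [if_neg (Nat.succ_ne_zero _), paramSeq_succ]

/-- Only blocks of size at least two have a first parameter, so the condition `c_1 ≠ 0` is imposed
on those alone and defines an open set. -/
theorem setOf_toGL_one_eq : {M : Idx r n p → Idx r n p → ℂ |
      ∃ X : WProd r n p, ∀ x y, M x y = toGL r n p X 1 x y} =
    paramMatrix r n p '' {c | ∀ (b : Blk p) (h : 0 < n b.1 - 1), c ⟨b, ⟨0, h⟩⟩ ≠ 0} := by
  ext M
  constructor
  · rintro ⟨X, hX⟩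
    choose c hc1 hc using fun b : Blk p => (X b.1 b.2).2
    refine ⟨fun κ => c κ.1 (κ.2 + 1), fun b h => hc1 b, ?_⟩
    have h1 : ∀ b : Blk p, muMatrix (n b.1) (paramSeq (fun κ : Param n p => c κ.1 (κ.2 + 1)) b) =
        muMatrix (n b.1) (c b) := by
      intro b
      refine muMatrix_congr fun k hk hk' => ?_
      rw [paramSeq, dif_pos ⟨hk, hk'⟩]
      exact congrArg (c b) (Nat.sub_add_cancel hk)
    ext x y
    rw [hX, toGL_one, coe_blockDiag, paramMatrix]
    simp only [h1, hc]
  · rintro ⟨c, hc, rfl⟩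
    have hex : ∀ b : Blk p, ∃ w ∈ wGroup r (n b.1),
        (w : Matrix (Fin (n b.1) × Fin r) (Fin (n b.1) × Fin r) ℂ) =
          muMatrix (n b.1) (paramSeq c b) ⊗ₖ (1 : Matrix (Fin r) (Fin r) ℂ) := by
      intro b
      by_cases h : 0 < n b.1 - 1
      · refine exists_wGroup_coe r (n b.1) ?_
        have h1 := paramSeq_succ c b ⟨0, h⟩
        rw [zero_add] at h1
        rw [h1]
        exact hc b h
      -- In a block of size at most one, `paramSeq` is zero at index `1`; another sequence replaces
      -- it, since `μ` does not see that entry.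
      · obtain ⟨w, hw, hwc⟩ := exists_wGroup_coe r (n b.1) (c := fun _ => 1) one_ne_zero
        refine ⟨w, hw, hwc.trans ?_⟩
        rw [muMatrix_congr (b := paramSeq c b) fun k h1 h2 => by omega]
    choose w hw hwc using hex
    refine ⟨fun i k => ⟨w ⟨i, k⟩, hw ⟨i, k⟩⟩, fun x y => ?_⟩
    rw [toGL_one, coe_blockDiag, paramMatrix]
    simp only [hwc]

theorem isComplexSubmanifold_setOf_toGL_one (hr : 0 < r) :
    IsComplexSubmanifold {M : Idx r n p → Idx r n p → ℂ |
      ∃ X : WProd r n p, ∀ x y, M x y = toGL r n p X 1 x y} (∑ i, p i * (n i - 1)) := by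
  have hdim : ∑ i, p i * (n i - 1) = Module.finrank ℂ (Param n p → ℂ) := by
    simp [Fintype.sum_sigma]
  let L : (Idx r n p → Idx r n p → ℂ) →ₗ[ℂ] (Param n p → ℂ) :=
    { toFun := fun M κ => M (paramEntry hr κ).1 (paramEntry hr κ).2
      map_add' := fun _ _ => rfl
      map_smul' := fun _ _ => rfl }
  -- A linear section of `L`: each parameter goes to its own entry in row one of its block, with
  -- zeros elsewhere.
  let J : (Param n p → ℂ) →ₗ[ℂ] (Idx r n p → Idx r n p → ℂ) :=
    { toFun := fun c x y => Function.ExtendByZero.linearMap ℂ (paramEntry hr) c (x, y)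
      map_add' := fun _ _ => by simp only [map_add]; rfl
      map_smul' := fun _ _ => by simp only [map_smul]; rfl }
  rw [setOf_toGL_one_eq, hdim]
  refine isComplexSubmanifold_image L.toContinuousLinearMap J.toContinuousLinearMap _
    (fun c => funext fun κ => ?_) (fun c => funext fun κ => paramMatrix_paramEntry hr c κ)
    differentiable_paramMatrix ?_
  · exact (paramEntry_injective hr).extend_apply c 0 κ
  · simp only [Set.ofPred_forall]
    refine isOpen_iInter_of_finite fun b => isOpen_iInter_of_finite fun h => ?_
    exact isOpen_ne_fun (continuous_apply _) continuous_const

end WeylJordan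

/-! ### The non-confluent case -/

namespace WeylJordan

theorem subsingleton_wGroup_one (r : ℕ) : Subsingleton (wGroup r 1) := by
  refine ⟨?_⟩
  rintro ⟨g, c, hc, hg⟩ ⟨g', c', hc', hg'⟩
  refine Subtype.ext (Units.ext ?_)
  change g.val = g'.val
  rw [hg, hg', muMatrix_congr (a := c) (b := c') fun k h1 h2 => by omega]

/-- In the non-confluent case, `W_λ` is the symmetric group. -/
noncomputable def permEquiv {r : ℕ} (hr : 0 < r) (m : ℕ) :
    Equiv.Perm (Fin m) ≃* weylGroup r (fun _ : Fin 1 => 1) (fun _ : Fin 1 => m) :=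
  (MulEquiv.ofBijective ((SemidirectProduct.inr :
      (∀ _ : Fin 1, Equiv.Perm (Fin m)) →*
        WProd r (fun _ : Fin 1 => 1) (fun _ : Fin 1 => m) ⋊[permAction r _ _] _).comp
      (MulEquiv.funUnique (Fin 1) (Equiv.Perm (Fin m))).symm.toMonoidHom)
    ⟨SemidirectProduct.inr_injective.comp (MulEquiv.injective _), fun x => by
      have := subsingleton_wGroup_one r
      exact ⟨x.right 0, SemidirectProduct.ext (funext fun i => funext fun k => Subsingleton.elim _ _)
        (funext fun i => by rw [Subsingleton.elim i 0]; rfl)⟩⟩).trans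
    (semidirectEquiv hr (Function.injective_of_subsingleton _) fun _ => one_pos)

end WeylJordan

/-! ### Structure of the Weyl group -/

theorem proposition3p10 (r : ℕ) (hr : 0 < r) (s : ℕ) (n p : Fin s → ℕ) (hn : StrictAnti n)
    (hn_pos : ∀ i, 0 < n i) (hp : ∀ i, 0 < p i) :
    -- the normalizer
    (hNormalizer r n p : Set (GL (Idx r n p) ℂ)) =
        {g | ∀ h ∈ hGroup r n p, g * h * g⁻¹ ∈ hGroup r n p} ∧
    -- the isomorphism of the product of the groups `W_r(n_i)^{p_i} ⋊ 𝔖_{p_i}` with `W_λ`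
    (∃ e : (∀ i, WreathW r (n i) (p i)) ≃* weylGroup r n p,
      ∀ x, ∃ g : ↥(hNormalizer r n p),
        (g : GL (Idx r n p) ℂ) = toGL r n p (fun i => (x i).left) (fun i => (x i).right) ∧
          e x = QuotientGroup.mk g) ∧
    -- `W_λ` as a semidirect product of `∏_i W_r(n_i)^{p_i}`, an open subgroup, and `∏_i 𝔖_{p_i}`
    (∃ e : WProd r n p ⋊[permAction r n p] (∀ i, Equiv.Perm (Fin (p i))) ≃* weylGroup r n p,
      (∀ x, ∃ g : ↥(hNormalizer r n p),
        (g : GL (Idx r n p) ℂ) = toGL r n p x.left x.right ∧ e x = QuotientGroup.mk g) ∧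
      Topology.IsOpenEmbedding fun X : WProd r n p => e (SemidirectProduct.inl X)) ∧
    -- `∏_i W_r(n_i)^{p_i}` is connected and has dimension `∑_i p_i (n_i - 1)`
    ConnectedSpace (WProd r n p) ∧
    IsComplexSubmanifold
      {M : Idx r n p → Idx r n p → ℂ | ∃ X : WProd r n p, ∀ x y, M x y = toGL r n p X 1 x y}
      (∑ i, p i * (n i - 1)) ∧
    -- the non-confluent case `λ = (1, …, 1)`
    (∀ m : ℕ, 0 < m →
      ∃ e : Equiv.Perm (Fin m) ≃* weylGroup r (fun _ : Fin 1 => 1) (fun _ : Fin 1 => m),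
        ∀ σ, ∃ g : ↥(hNormalizer r (fun _ : Fin 1 => 1) (fun _ : Fin 1 => m)),
          (g : GL (Idx r (fun _ : Fin 1 => 1) (fun _ : Fin 1 => m)) ℂ) =
              permGL r (fun _ : Fin 1 => 1) (fun _ : Fin 1 => m) (fun _ => σ) ∧
            e σ = QuotientGroup.mk g) := by
  refine ⟨hNormalizer_eq hr hn.injective hn_pos,
    ⟨(wreathEquiv r n p).trans (semidirectEquiv hr hn.injective hn_pos),
      fun x => ⟨toNormalizer r n p (wreathEquiv r n p x), rfl, rfl⟩⟩,
    ⟨semidirectEquiv hr hn.injective hn_pos, fun x => ⟨toNormalizer r n p x, rfl, rfl⟩,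
      isOpenEmbedding_semidirectEquiv_inl hr hn.injective hn_pos⟩,
    inferInstance, isComplexSubmanifold_setOf_toGL_one hr, fun m _ => ⟨permEquiv hr m, fun σ => ?_⟩⟩
  refine ⟨toNormalizer r _ _ (SemidirectProduct.inr fun _ => σ), ?_, rfl⟩
  change blockDiag r _ _ 1 * permGL r _ _ (fun _ => σ) = _
  rw [map_one, one_mul]
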